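/- All groups are finite. For a group $G$ and a subset $S\subseteq G$, let $\mathrm{Cay}(G,S)$ be the digraph with vertex set $G$ in which $(x,y)$ is an arc if and only if $yx^{-1}\in S$; $G$ acts on it by automorphisms via right multiplication. We say that $G$ admits an oriented regular representation (ORR) if there is a subset $S\subseteq G$ with $S\cap S^{-1}=\emptyset$ such that $\mathrm{Aut}(\mathrm{Cay}(G,S))=G$, that is, every automorphism of $\mathrm{Cay}(G,S)$ is a right multiplication $x\mapsto xg$ with $g\in G$. We say that $G$ is generalized dihedral if $G$ contains an abelian subgroup $A$ with $|G:A|=2$ and an element $\tau\in G\setminus A$ such that $\tau^2=1$ and $\tau^{-1}a\tau=a^{-1}$ for every $a\in A$. Let $d(G)$ denote the minimum cardinality of a generating set of $G$, let $C_n$ be the cyclic group of order $n$, and write $x^z=z^{-1}xz$. Theorem. Let $G$ be a finite group with $d(G)=3$. Then one of the following holds: (i) $G$ is generalized dihedral; (ii) $G$ admits an ORR; (iii) $G$ is isomorphic to one of the following four groups: - $C_4\times C_2^2$, - $C_3\times C_2^3$, - $\langle x,y,z\mid x^4=y^4=z^4=(xy)^2=(xy^{-1})^2=(xz)^2=(xz^{-1})^2=(yz)^2=(yz^{-1})^2=x^2y^2z^2=1\rangle$,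 which has order $32$, - $\langle x,y,z\mid x^4=y^4=z^4=(yx)^2=(yx^{-1})^2=(yz)^2=(yz^{-1})^2=1,\ x^2=z^2,\ x^z=x^{-1},\ x^2=y^2\rangle$, which has order $16$. Furthermore, the generalized dihedral groups $G$ with $d(G)=3$ and the four groups listed in (iii) admit no ORR. -/

import Mathlib

namespace ORR

open scoped Pointwise

/-- The Cayley digraph `Cay(G, S)`: vertex set `G`, with an arc `(x, y)` iff `y x⁻¹ ∈ S`. -/
def cayley {G : Type*} [Group G] (S : Set G) : Digraph G where
  Adj x y := y * x⁻¹ ∈ S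

/-- The automorphism group of a digraph, as a group of permutations of its vertices. -/
def digraphAut {V : Type*} (Γ : Digraph V) : Subgroup (Equiv.Perm V) where
  carrier := {φ | ∀ x y, Γ.Adj (φ x) (φ y) ↔ Γ.Adj x y}
  mul_mem' := fun {φ ψ} hφ hψ x y => (hφ (ψ x) (ψ y)).trans (hψ x y)
  one_mem' := fun _ _ => Iff.rfl
  inv_mem' := fun {φ} hφ x y => by
    have h := hφ (φ⁻¹ x) (φ⁻¹ y)
    simpa using h.symm

/-- The image of the right regular representation of `G` in `Sym(G)`: the group of all
right translations `x ↦ x g`. -/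
def rightRegular (G : Type*) [Group G] : Subgroup (Equiv.Perm G) :=
  (MulAction.toPermHom Gᵐᵒᵖ G).range

/-- `G` admits an oriented regular representation: for some `S ⊆ G` with `S ∩ S⁻¹ = ∅`, the full
automorphism group of `Cay(G, S)` is `G` in its right regular representation. -/
def AdmitsORR (G : Type*) [Group G] : Prop :=
  ∃ S : Set G, S ∩ S⁻¹ = ∅ ∧ digraphAut (cayley S) = rightRegular G

/-- `G` is generalized dihedral: it has an abelian subgroup `A` of index `2` and an element
`τ ∉ A` with `τ² = 1` that inverts every element of `A` by conjugation. -/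
def IsGeneralizedDihedral (G : Type*) [Group G] : Prop :=
  ∃ A : Subgroup G, (∀ a ∈ A, ∀ b ∈ A, a * b = b * a) ∧ A.index = 2 ∧
    ∃ τ : G, τ ∉ A ∧ τ ^ 2 = 1 ∧ ∀ a ∈ A, τ⁻¹ * a * τ = a⁻¹

/-- The cyclic group of order `n` (for `n ≥ 1`), written multiplicatively. -/
abbrev C (n : ℕ) : Type := Multiplicative (ZMod n)

/-- The relators of `Group32`, as words in `x`, `y`, `z`. -/
def relators32 {F : Type*} [Group F] (x y z : F) : Set F :=
  {x ^ 4, y ^ 4, z ^ 4, (x * y) ^ 2, (x * y⁻¹) ^ 2, (x * z) ^ 2, (x * z⁻¹) ^ 2,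
    (y * z) ^ 2, (y * z⁻¹) ^ 2, x ^ 2 * y ^ 2 * z ^ 2}

/-- The relators of `Group16`, as words in `x`, `y`, `z`. The last three express
`x² = z²`, `z⁻¹ x z = x⁻¹` and `x² = y²`. -/
def relators16 {F : Type*} [Group F] (x y z : F) : Set F :=
  {x ^ 4, y ^ 4, z ^ 4, (y * x) ^ 2, (y * x⁻¹) ^ 2, (y * z) ^ 2, (y * z⁻¹) ^ 2,
    x ^ 2 * (z ^ 2)⁻¹, z⁻¹ * x * z * (x⁻¹)⁻¹, x ^ 2 * (y ^ 2)⁻¹}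

/-- `⟨x, y, z ∣ x⁴ = y⁴ = z⁴ = (xy)² = (xy⁻¹)² = (xz)² = (xz⁻¹)² = (yz)² = (yz⁻¹)² = x²y²z² = 1⟩` -/
abbrev Group32 : Type :=
  PresentedGroup
    (relators32 (FreeGroup.of (0 : Fin 3)) (FreeGroup.of (1 : Fin 3)) (FreeGroup.of (2 : Fin 3)))

/-- `⟨x, y, z ∣ x⁴ = y⁴ = z⁴ = (yx)² = (yx⁻¹)² = (yz)² = (yz⁻¹)² = 1, x² = z², xᶻ = x⁻¹, x² = y²⟩` -/
abbrev Group16 : Type :=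
  PresentedGroup
    (relators16 (FreeGroup.of (0 : Fin 3)) (FreeGroup.of (1 : Fin 3)) (FreeGroup.of (2 : Fin 3)))

/-- `G` is isomorphic to one of the four exceptional groups. -/
def IsExceptional (G : Type*) [Group G] : Prop :=
  Nonempty (G ≃* C 4 × (Fin 2 → C 2)) ∨ Nonempty (G ≃* C 3 × (Fin 3 → C 2)) ∨
    Nonempty (G ≃* Group32) ∨ Nonempty (G ≃* Group16)

end ORR

/-!
An automorphism of `Cay(G, S)` fixing `1` permutes `S` and preserves the digraph it induces there,
so an ORR arises from a generating set `S` with `S ∩ S⁻¹ = ∅` whose elements are told apart by that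
digraph. If `x, y, z` generate `G` and no two elements do, then `z` together with a few words in `x`
and `y` is such a set unless `x` and `y` satisfy one of a short list of relations. So suppose that
`G` has no ORR and is not generalized dihedral. If some generator `x` has `x ^ 4 ≠ 1`, these
relations make `G` abelian, and only `C₃ × C₂³` survives. Otherwise squares are central of order at
most `2`, so modulo squares `G` is `𝔽₂³`, and `G` is determined by labelling the seven points of the
Fano plane by squares. The relations restrict the labels on each line, and each remaining labelling
is realised by an explicit central extension of `𝔽₂³`, which is generalized dihedral, has an ORR
found by computation, or is exceptional.

Conversely, a group automorphism preserving `S` is an automorphism of `Cay(G, S)`, and in an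
exceptional group every `S` with `S ∩ S⁻¹ = ∅` is preserved by a nontrivial one. In a generalized
dihedral group such an `S` lies in the abelian subgroup `A`, because all other elements are
involutions, so `Cay(G, S)` is disconnected.
-/

namespace ORR

section CayleyDigraph

variable {G : Type*} [Group G] {S : Set G} {φ : Equiv.Perm G}

theorem mem_digraphAut_cayley :
    φ ∈ digraphAut (cayley S) ↔ ∀ x y, φ y * (φ x)⁻¹ ∈ S ↔ y * x⁻¹ ∈ S := Iff.rfl

theorem mem_rightRegular : φ ∈ rightRegular G ↔ ∃ g, ∀ x, φ x = x * g := by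
  constructor
  · rintro ⟨g, rfl⟩
    exact ⟨g.unop, fun x => rfl⟩
  · rintro ⟨g, hg⟩
    exact ⟨MulOpposite.op g, Equiv.ext fun x => (hg x).symm⟩

theorem mulRight_mem_digraphAut (S : Set G) (g : G) :
    Equiv.mulRight g ∈ digraphAut (cayley S) := by
  intro x y
  simp [cayley, mul_assoc]

theorem apply_mem_iff (hφ : φ ∈ digraphAut (cayley S)) (h1 : φ 1 = 1) (x : G) :
    φ x ∈ S ↔ x ∈ S := by
  simpa [h1] using mem_digraphAut_cayley.1 hφ 1 x

/-- The elements of `G` fixed by every automorphism of `Cay(G, S)` that fixes `1` (see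
`mem_fixedSubgroup`). They are encoded as the elements whose left translation commutes with all
automorphisms, because this makes the subgroup property immediate. -/
def fixedSubgroup (S : Set G) : Subgroup G where
  carrier := {g | ∀ φ ∈ digraphAut (cayley S), ∀ x, φ (g * x) = g * φ x}
  mul_mem' ha hb φ hφ x := by rw [mul_assoc, ha φ hφ, hb φ hφ, mul_assoc]
  one_mem' φ _ x := by rw [one_mul, one_mul]
  inv_mem' hg φ hφ x := by rw [eq_inv_mul_iff_mul_eq, ← hg φ hφ, mul_inv_cancel_left]

theorem mem_fixedSubgroup {g : G} :
    g ∈ fixedSubgroup S ↔ ∀ φ ∈ digraphAut (cayley S), φ 1 = 1 → φ g = g := by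
  refine ⟨fun h φ hφ h1 => by simpa [h1] using h φ hφ 1, fun h φ hφ x => ?_⟩
  have := h (Equiv.mulRight (φ x)⁻¹ * φ * Equiv.mulRight x)
    (mul_mem (mul_mem (mulRight_mem_digraphAut S _) hφ) (mulRight_mem_digraphAut S _)) (by simp)
  simpa [mul_inv_eq_iff_eq_mul] using this

theorem digraphAut_eq_rightRegular_iff :
    digraphAut (cayley S) = rightRegular G ↔ fixedSubgroup S = ⊤ := by
  refine ⟨fun h => (Subgroup.eq_top_iff' _).2 fun g => mem_fixedSubgroup.2 fun φ hφ h1 => ?_,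
    fun h => ?_⟩
  · obtain ⟨u, hu⟩ := mem_rightRegular.1 (h ▸ hφ)
    have hu1 : u = 1 := by simpa [h1] using (hu 1).symm
    rw [hu, hu1, mul_one]
  · ext φ
    refine ⟨fun hφ => mem_rightRegular.2 ⟨φ 1, fun x => ?_⟩, fun hφ => ?_⟩
    · simpa using (h ▸ Subgroup.mem_top x : x ∈ fixedSubgroup S) φ hφ 1
    · obtain ⟨g, hg⟩ := mem_rightRegular.1 hφ
      exact (Equiv.ext hg : φ = Equiv.mulRight g) ▸ mulRight_mem_digraphAut S g

theorem inter_inv_eq_empty_iff : S ∩ S⁻¹ = ∅ ↔ ∀ a ∈ S, ∀ b ∈ S, a * b ≠ 1 := by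
  simp only [Set.eq_empty_iff_forall_notMem, Set.mem_inter_iff, Set.mem_inv, not_and]
  refine ⟨fun h a ha b hb hab => h a ha ?_, fun h a ha ha' => h a ha _ ha' (mul_inv_cancel a)⟩
  rwa [inv_eq_of_mul_eq_one_right hab]

theorem admitsORR_iff :
    AdmitsORR G ↔ ∃ S : Set G, (∀ a ∈ S, ∀ b ∈ S, a * b ≠ 1) ∧ fixedSubgroup S = ⊤ := by
  simp only [AdmitsORR, inter_inv_eq_empty_iff, digraphAut_eq_rightRegular_iff]

theorem AdmitsORR.of_mulEquiv {H : Type*} [Group H] (f : G ≃* H) (hG : AdmitsORR G) :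
    AdmitsORR H := by
  obtain ⟨S, hS, hfix⟩ := admitsORR_iff.1 hG
  refine admitsORR_iff.2 ⟨f.symm ⁻¹' S, fun a ha b hb hab => ?_,
    (Subgroup.eq_top_iff' _).2 fun h => mem_fixedSubgroup.2 fun φ hφ h1 => ?_⟩
  · exact hS _ ha _ hb (by rw [← map_mul, hab, map_one])
  · have hψ : f.toEquiv.permCongr.symm φ ∈ digraphAut (cayley S) := fun a b => by
      simpa [cayley] using mem_digraphAut_cayley.1 hφ (f a) (f b)
    have := mem_fixedSubgroup.1 (hfix ▸ Subgroup.mem_top (f.symm h)) _ hψ (by simp [h1])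
    simpa using this

end CayleyDigraph

section RigidConnectionSets

variable {G : Type*} [Group G] {ι : Type*} {f : ι → G}

/-- The digraph that `Cay(G, S)` induces on its connection set `S`, where `S` is the range of an
injective family `f` and vertices are replaced by their indices. -/
def ArcOn (f : ι → G) (i j : ι) : Prop := ∃ k, f k * f i = f j

theorem mul_inv_mem_range_iff {i j : ι} : f j * (f i)⁻¹ ∈ Set.range f ↔ ArcOn f i j := by
  simp only [ArcOn, Set.mem_range, eq_mul_inv_iff_mul_eq]

theorem admitsORR_of_range (hinv : ∀ i j, f i * f j ≠ 1)
    (hgen : Subgroup.closure (Set.range f) = ⊤) (hfix : ∀ i, f i ∈ fixedSubgroup (Set.range f)) :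
    AdmitsORR G := by
  refine admitsORR_iff.2 ⟨Set.range f, ?_, top_le_iff.1 (hgen ▸ (Subgroup.closure_le _).2 ?_)⟩
  · rintro _ ⟨i, rfl⟩ _ ⟨j, rfl⟩
    exact hinv i j
  · rintro _ ⟨i, rfl⟩
    exact hfix i

theorem exists_perm_of_mem_digraphAut (hf : Function.Injective f) {φ : Equiv.Perm G}
    (hφ : φ ∈ digraphAut (cayley (Set.range f))) (h1 : φ 1 = 1) :
    ∃ σ : Equiv.Perm ι, ∀ i, f (σ i) = φ (f i) :=
  ⟨(Equiv.ofInjective f hf).symm.permCongr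
    (φ.subtypePerm (p := (· ∈ Set.range f)) (apply_mem_iff hφ h1)),
    fun i => by simp [Equiv.apply_ofInjective_symm hf]⟩

theorem mem_fixedSubgroup_of_rigid (hf : Function.Injective f) {i : ι}
    (hi : ∀ σ : Equiv.Perm ι, (∀ a b, ArcOn f (σ a) (σ b) ↔ ArcOn f a b) → σ i = i) :
    f i ∈ fixedSubgroup (Set.range f) := by
  refine mem_fixedSubgroup.2 fun φ hφ h1 => ?_
  obtain ⟨σ, hσ⟩ := exists_perm_of_mem_digraphAut hf hφ h1
  rw [← hσ, hi σ fun a b => ?_]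
  rw [← mul_inv_mem_range_iff, ← mul_inv_mem_range_iff, hσ, hσ]
  exact mem_digraphAut_cayley.1 hφ _ _

theorem mem_fixedSubgroup_of_forall_ne (hf : Function.Injective f) {i : ι}
    (hi : ∀ j ≠ i, f j ∈ fixedSubgroup (Set.range f)) : f i ∈ fixedSubgroup (Set.range f) := by
  refine mem_fixedSubgroup.2 fun φ hφ h1 => ?_
  obtain ⟨σ, hσ⟩ := exists_perm_of_mem_digraphAut hf hφ h1
  by_contra hne
  have hσi : σ i ≠ i := fun h => hne (by rw [← hσ, h])
  have hfix := mem_fixedSubgroup.1 (hi _ hσi) φ hφ h1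
  rw [← hσ] at hfix
  exact hσi (σ.injective (hf hfix))

/-- The relation on `Option ι` that extends `R` by an isolated point. -/
def isolated (R : ι → ι → Bool) : Option ι → Option ι → Bool
  | some i, some j => R i j
  | _, _ => false

variable {e : ι → G} {z : G}

theorem optionElim_injective (he : Function.Injective e)
    (hz : z ∉ Subgroup.closure (Set.range e)) :
    Function.Injective fun o : Option ι => o.elim z e := by
  have hmem : ∀ i, e i ≠ z := fun i h => hz (h ▸ Subgroup.subset_closure ⟨i, rfl⟩)
  rintro (_ | i) (_ | j) hij
  · rfl
  · exact absurd hij.symm (hmem j)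
  · exact absurd hij (hmem i)
  · exact congrArg some (he hij)

theorem optionElim_mul_ne_one (hz : z ∉ Subgroup.closure (Set.range e)) (hz2 : z * z ≠ 1)
    (he : ∀ i j, e i * e j ≠ 1) (a b : Option ι) : a.elim z e * b.elim z e ≠ 1 := by
  have hmem : ∀ i, (e i)⁻¹ ≠ z := fun i h => hz (h ▸ inv_mem (Subgroup.subset_closure ⟨i, rfl⟩))
  rcases a with _ | i <;> rcases b with _ | j
  · exact hz2
  · exact fun h => hmem j (inv_eq_of_mul_eq_one_left h)
  · exact fun h => hmem i (inv_eq_of_mul_eq_one_right h)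
  · exact he i j

theorem arcOn_optionElim {R : ι → ι → Bool} (hz : z ∉ Subgroup.closure (Set.range e))
    (he1 : ∀ i, e i ≠ 1) (hzz : ∀ i, z * z ≠ e i) (hR : ∀ i j, ArcOn e i j ↔ R i j)
    (a b : Option ι) : ArcOn (fun o : Option ι => o.elim z e) a b ↔ isolated R a b := by
  set H := Subgroup.closure (Set.range e)
  have hmem : ∀ i, e i ∈ H := fun i => Subgroup.subset_closure ⟨i, rfl⟩
  have hmul : ∀ i j k, z * e i ≠ e j ∧ e i * z ≠ e j ∧ e i * e j ≠ z ∧ e i * e k ≠ z :=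
    fun i j k => ⟨fun h => hz ((H.mul_mem_cancel_right (hmem i)).1 (h ▸ hmem j)),
      fun h => hz ((H.mul_mem_cancel_left (hmem i)).1 (h ▸ hmem j)),
      fun h => hz (h ▸ mul_mem (hmem i) (hmem j)), fun h => hz (h ▸ mul_mem (hmem i) (hmem k))⟩
  have hz1 : z ≠ 1 := fun h => hz (h ▸ one_mem H)
  simp only [ArcOn, Option.exists] at hR ⊢
  rcases a with _ | i <;> rcases b with _ | j
  · simp [isolated, hz1, he1]
  · simp [isolated, hzz, fun k => (hmul k j k).2.1]
  · simp [isolated, he1, fun k => (hmul k i k).2.2.1]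
  · simp [isolated, hmul i j i, hR]

/-- The generator `z` is an isolated vertex of the digraph induced on the connection set, and `R`
is the digraph induced on the rest of it. -/
theorem admitsORR_of_rigid (I : Set ι) (R : ι → ι → Bool) (he : Function.Injective e)
    (hz : z ∉ Subgroup.closure (Set.range e))
    (hgen : Subgroup.closure (insert z (Set.range e)) = ⊤)
    (hI : ∀ i, e i ∈ Subgroup.closure (e '' I)) (hinv : ∀ i j, e i * e j ≠ 1)
    (hz2 : z * z ≠ 1) (hzz : ∀ i, z * z ≠ e i) (hR : ∀ i j, ArcOn e i j ↔ R i j)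
    (hrigid : ∀ σ : Equiv.Perm (Option ι),
      (∀ a b, isolated R (σ a) (σ b) = isolated R a b) → ∀ i ∈ I, σ (some i) = some i) :
    AdmitsORR G := by
  let f : Option ι → G := fun o => o.elim z e
  have hf : Function.Injective f := optionElim_injective he hz
  have he1 : ∀ i, e i ≠ 1 := fun i h => hinv i i (by rw [h, one_mul])
  have hfI : e '' I ⊆ fixedSubgroup (Set.range f) := by
    rintro _ ⟨i, hi, rfl⟩
    refine mem_fixedSubgroup_of_rigid (i := some i) hf fun σ hσ => hrigid σ (fun a b => ?_) i hi
    simpa only [f, arcOn_optionElim hz he1 hzz hR, ← Bool.eq_iff_iff] using hσ a b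
  have hsome : ∀ i, f (some i) ∈ fixedSubgroup (Set.range f) := fun i =>
    (Subgroup.closure_le (fixedSubgroup (Set.range f))).2 hfI (hI i)
  have hrange : Set.range f = insert z (Set.range e) := by
    ext g
    simp [f, Option.exists, eq_comm]
  refine admitsORR_of_range (optionElim_mul_ne_one hz hz2 hinv) (hrange ▸ hgen) ?_
  rintro (_ | i)
  · refine mem_fixedSubgroup_of_forall_ne hf ?_
    rintro (_ | i) hi
    exacts [absurd rfl hi, hsome i]
  · exact hsome i

end RigidConnectionSets

section PathWeights

variable {G : Type*} [Group G] [DecidableEq G] {n : ℕ} {e : Fin n → G}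

/-- The number of directed paths of length one and two from `s` to `t` in `Cay(G, S)`, `S` the
range of the injective family `e`, packed into one number: arcs count `100`, and paths of length two
count `1`. -/
def pathWeight (e : Fin n → G) (s t : G) : ℕ :=
  (if ∃ k, e k * s = t then 100 else 0) +
    (Finset.univ.filter fun k => ∃ m, e m * (e k * s) = t).card

theorem pathWeight_apply (he : Function.Injective e) {φ : Equiv.Perm G}
    (hφ : φ ∈ digraphAut (cayley (Set.range e))) (s t : G) :
    pathWeight e (φ s) (φ t) = pathWeight e s t := by
  have hadj : ∀ a b, (∃ k, e k * φ a = φ b) ↔ ∃ k, e k * a = b := by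
    intro a b
    simpa only [Set.mem_range, eq_mul_inv_iff_mul_eq] using mem_digraphAut_cayley.1 hφ a b
  -- `φ` followed by the translation that brings `φ s` back to `s` permutes the steps out of `s`.
  let ψ : Equiv.Perm G := Equiv.mulRight (φ s)⁻¹ * φ * Equiv.mulRight s
  obtain ⟨σ, hσ⟩ := exists_perm_of_mem_digraphAut he (φ := ψ)
    (mul_mem (mul_mem (mulRight_mem_digraphAut _ _) hφ) (mulRight_mem_digraphAut _ _)) (by simp [ψ])
  have hstep : ∀ k, e (σ k) * φ s = φ (e k * s) := fun k => by simp [hσ, ψ]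
  simp only [pathWeight, hadj]
  congr 1
  refine (Finset.card_equiv σ fun k => ?_).symm
  simp [hstep, hadj]

/-- Here `W` is the matrix of path weights between the elements of the connection set, and the
`i`-th entry of its product with its vector of row square sums is an invariant of the vertex
`e i`. -/
theorem admitsORR_of_pathWeight (he : Function.Injective e) (hinv : ∀ i j, e i * e j ≠ 1)
    (hgen : Subgroup.closure (Set.range e) = ⊤) (W : Fin n → Fin n → ℕ)
    (hW : ∀ i j, pathWeight e (e i) (e j) = W i j)
    (hinj : Function.Injective fun i => ∑ j, W i j * ∑ k, W j k ^ 2) : AdmitsORR G := by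
  refine admitsORR_of_range hinv hgen fun i => mem_fixedSubgroup.2 fun φ hφ h1 => ?_
  obtain ⟨σ, hσ⟩ := exists_perm_of_mem_digraphAut he hφ h1
  have hσW : ∀ i j, W (σ i) (σ j) = W i j := fun i j => by
    rw [← hW, ← hW, hσ, hσ, pathWeight_apply he hφ]
  have hrow : ∀ j, ∑ k, W (σ j) k ^ 2 = ∑ k, W j k ^ 2 := fun j => by
    rw [← Equiv.sum_comp σ]
    simp only [hσW]
  rw [← hσ, hinj (a₁ := σ i) (a₂ := i)]
  dsimp only
  rw [← Equiv.sum_comp σ]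
  simp only [hσW, hrow]

end PathWeights

section GeneratingTriples

variable {G : Type*} [Group G] {x y z : G}

theorem mem_closure_pair_left (x y : G) : x ∈ Subgroup.closure {x, y} :=
  Subgroup.subset_closure (by simp)

theorem mem_closure_pair_right (x y : G) : y ∈ Subgroup.closure {x, y} :=
  Subgroup.subset_closure (by simp)

theorem closure_pair_le {H : Subgroup G} (hx : x ∈ H) (hy : y ∈ H) :
    Subgroup.closure {x, y} ≤ H := by
  rw [Subgroup.closure_le]
  rintro g (rfl | rfl) <;> assumption

/-- The elements `x`, `y`, `z` generate the group. -/
def Generates (x y z : G) : Prop := Subgroup.closure {x, y, z} = ⊤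

theorem Generates.eq_top (h : Generates x y z) {H : Subgroup G} (hx : x ∈ H) (hy : y ∈ H)
    (hz : z ∈ H) : H = ⊤ := by
  refine top_le_iff.1 (h ▸ (Subgroup.closure_le _).2 ?_)
  rintro g (rfl | rfl | rfl) <;> assumption

theorem Generates.trans {x' y' z' : G} (h : Generates x y z)
    (hx : x ∈ Subgroup.closure {x', y', z'}) (hy : y ∈ Subgroup.closure {x', y', z'})
    (hz : z ∈ Subgroup.closure {x', y', z'}) : Generates x' y' z' :=
  h.eq_top hx hy hz

/-- The elements `x`, `y`, `z` generate the group and no two elements do: such triples exist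
exactly in the groups with `d(G) = 3`. -/
structure IsMinTriple (x y z : G) : Prop where
  generates : Generates x y z
  closure_pair_ne_top : ∀ a b : G, Subgroup.closure {a, b} ≠ ⊤

namespace IsMinTriple

theorem swap₁₂ (h : IsMinTriple x y z) : IsMinTriple y x z := by
  refine ⟨?_, h.closure_pair_ne_top⟩
  rw [Generates, Set.insert_comm]
  exact h.generates

theorem swap₂₃ (h : IsMinTriple x y z) : IsMinTriple x z y := by
  refine ⟨?_, h.closure_pair_ne_top⟩
  rw [Generates, Set.pair_comm]
  exact h.generates

theorem mul₃ (h : IsMinTriple x y z) {a b : G} (ha : a ∈ Subgroup.closure {x, y})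
    (hb : b ∈ Subgroup.closure {x, y}) : IsMinTriple x y (a * z * b) := by
  set H := Subgroup.closure {x, y, a * z * b}
  have hxH : x ∈ H := Subgroup.subset_closure (by simp)
  have hyH : y ∈ H := Subgroup.subset_closure (by simp)
  have hwH : a * z * b ∈ H := Subgroup.subset_closure (by simp)
  have hle := closure_pair_le hxH hyH
  refine ⟨h.generates.trans hxH hyH ?_, h.closure_pair_ne_top⟩
  rwa [← H.mul_mem_cancel_left (hle ha), ← H.mul_mem_cancel_right (hle hb)]

theorem mul₃_left (h : IsMinTriple x y z) {a : G} (ha : a ∈ Subgroup.closure {x, y}) :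
    IsMinTriple x y (a * z) := by
  simpa using h.mul₃ ha (one_mem _)

theorem mul₃_right (h : IsMinTriple x y z) {b : G} (hb : b ∈ Subgroup.closure {x, y}) :
    IsMinTriple x y (z * b) := by
  simpa using h.mul₃ (one_mem _) hb

theorem mul_pow₂ (h : IsMinTriple x y z) (n : ℕ) : IsMinTriple x (y * x ^ n) z :=
  (h.swap₂₃.mul₃_right (pow_mem (mem_closure_pair_left x z) n)).swap₂₃

theorem inv₁ (h : IsMinTriple x y z) : IsMinTriple x⁻¹ y z := by
  refine ⟨h.generates.trans (inv_mem_iff.1 ?_) ?_ ?_, h.closure_pair_ne_top⟩ <;>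
    exact Subgroup.subset_closure (by simp)

theorem notMem_closure_pair (h : IsMinTriple x y z) : z ∉ Subgroup.closure {x, y} := fun hz =>
  h.closure_pair_ne_top x y
    (h.generates.eq_top (mem_closure_pair_left x y) (mem_closure_pair_right x y) hz)

theorem ne_one₁ (h : IsMinTriple x y z) : x ≠ 1 := by
  rintro rfl
  exact h.swap₁₂.swap₂₃.notMem_closure_pair (one_mem _)

theorem notMem_zpowers (h : IsMinTriple x y z) {g : G}
    (hx : x ∈ Subgroup.zpowers g) : y ∉ Subgroup.zpowers g := by
  intro hy
  have hle : Subgroup.zpowers g ≤ Subgroup.closure {g, z} :=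
    Subgroup.zpowers_le.2 (mem_closure_pair_left g z)
  exact h.closure_pair_ne_top g z
    (h.generates.eq_top (hle hx) (hle hy) (mem_closure_pair_right g z))

theorem closure_pair_sup_closure (h : IsMinTriple x y z) :
    Subgroup.closure {x, y} ⊔ Subgroup.closure {z} = ⊤ := by
  refine h.generates.eq_top (Subgroup.mem_sup_left (mem_closure_pair_left x y))
    (Subgroup.mem_sup_left (mem_closure_pair_right x y)) (Subgroup.mem_sup_right ?_)
  exact Subgroup.mem_closure_singleton_self z

end IsMinTriple

end GeneratingTriples

section GeneralizedDihedral

variable {G : Type*} [Group G] {x y z t : G} {H : Subgroup G}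

theorem inv_eq_self_of_sq_eq_one (ht : t ^ 2 = 1) : t⁻¹ = t :=
  inv_eq_of_mul_eq_one_left (by rw [← pow_two, ht])

theorem conj_mul_conj (t a b : G) : t⁻¹ * a * t * (t⁻¹ * b * t) = t⁻¹ * (a * b) * t := by group

theorem mul_comm_of_conj_eq_inv (hinv : ∀ a ∈ H, t⁻¹ * a * t = a⁻¹) {a b : G} (ha : a ∈ H)
    (hb : b ∈ H) : a * b = b * a := by
  have h := conj_mul_conj t a b
  rw [hinv a ha, hinv b hb, hinv _ (mul_mem ha hb), ← mul_inv_rev] at h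
  exact (inv_injective h).symm

theorem index_eq_two_of_involution (ht : t ∉ H) (ht2 : t ^ 2 = 1)
    (hconj : ∀ a ∈ H, t * a * t ∈ H) (hgen : H ⊔ Subgroup.closure {t} = ⊤) : H.index = 2 := by
  have htt : t * t = 1 := by rw [← pow_two, ht2]
  let K : Subgroup G :=
    { carrier := {b | b * t ∈ H ∨ b ∈ H}
      one_mem' := Or.inr (one_mem H)
      mul_mem' := by
        rintro a b (ha | ha) (hb | hb)
        · have := mul_mem ha (hconj _ hb)
          refine Or.inr ?_
          rwa [mul_assoc, mul_assoc t, mul_assoc b, htt, mul_one, ← mul_assoc t, htt,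
            one_mul] at this
        · have := mul_mem ha (hconj _ hb)
          refine Or.inl ?_
          rwa [← mul_assoc, ← mul_assoc, mul_assoc a, htt, mul_one] at this
        · exact Or.inl (by rw [mul_assoc]; exact mul_mem ha hb)
        · exact Or.inr (mul_mem ha hb)
      inv_mem' := by
        rintro a (ha | ha)
        · have := hconj _ (inv_mem ha)
          rw [mul_inv_rev, mul_inv_cancel_left] at this
          exact Or.inl this
        · exact Or.inr (inv_mem ha) }
  have hK : H ⊔ Subgroup.closure {t} ≤ K := by
    refine sup_le (fun a ha => Or.inr ha) ((Subgroup.closure_le K).2 ?_)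
    rintro _ rfl
    exact Or.inl (htt ▸ one_mem H)
  exact Subgroup.index_eq_two_iff_exists_notMem_and.2
    ⟨t, ht, fun b => hK (hgen ▸ Subgroup.mem_top b)⟩

theorem isGeneralizedDihedral_of_inverts (ht : t ∉ H) (ht2 : t ^ 2 = 1)
    (hinv : ∀ a ∈ H, t⁻¹ * a * t = a⁻¹) (hgen : H ⊔ Subgroup.closure {t} = ⊤) :
    IsGeneralizedDihedral G := by
  refine ⟨H, fun a ha b hb => mul_comm_of_conj_eq_inv hinv ha hb,
    index_eq_two_of_involution ht ht2 (fun a ha => ?_) hgen, t, ht, ht2, hinv⟩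
  have := hinv a ha
  rw [inv_eq_self_of_sq_eq_one ht2] at this
  exact this ▸ inv_mem ha

namespace IsMinTriple

/-- Otherwise every element of the coset of `z` modulo `⟨x, y⟩` is an involution, so `z`
inverts `⟨x, y⟩`. -/
theorem exists_sq_ne_one (hD : ¬ IsGeneralizedDihedral G) (h : IsMinTriple x y z) :
    ∃ w, IsMinTriple x y w ∧ w ^ 2 ≠ 1 := by
  by_contra! hw
  have hz2 : z ^ 2 = 1 := hw z h
  refine hD (isGeneralizedDihedral_of_inverts h.notMem_closure_pair hz2 (fun a ha => ?_)
    h.closure_pair_sup_closure)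
  have haz : a * z * (a * z) = 1 := by rw [← pow_two, hw _ (h.mul₃_left ha)]
  rw [inv_eq_self_of_sq_eq_one hz2, mul_assoc]
  exact eq_inv_of_mul_eq_one_right (by rw [← mul_assoc, ← mul_assoc, mul_assoc (a * z), haz])

theorem isGeneralizedDihedral (h : IsMinTriple x y t) (hxy : Commute x y) (ht : t ^ 2 = 1)
    (hx : t⁻¹ * x * t = x⁻¹) (hy : t⁻¹ * y * t = y⁻¹) : IsGeneralizedDihedral G := by
  refine isGeneralizedDihedral_of_inverts h.notMem_closure_pair ht (fun a ha => ?_)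
    h.closure_pair_sup_closure
  have hcomm : IsMulCommutative (Subgroup.closure {x, y}) :=
    Subgroup.isMulCommutative_closure (by rintro a (rfl | rfl) b (rfl | rfl) <;> simp [hxy.eq])
  induction ha using Subgroup.closure_induction with
  | mem g hg => rcases hg with rfl | rfl <;> assumption
  | one => simp
  | mul a b ha hb iha ihb =>
    rw [← conj_mul_conj, iha, ihb, ← mul_inv_rev, setLike_mul_comm ha hb]
  | inv a _ ih =>
    have : t⁻¹ * a⁻¹ * t = (t⁻¹ * a * t)⁻¹ := by group
    rw [this, ih]

end IsMinTriple

/-- Outside a nontrivial proper subgroup `A` containing the connection set, right translation by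
an element of `A` is an automorphism that does not move `A`. -/
theorem eq_top_of_fixedSubgroup_eq_top {S : Set G} (hS : fixedSubgroup S = ⊤) (hSH : S ⊆ H)
    (hH : H ≠ ⊥) : H = ⊤ := by
  classical
  obtain ⟨⟨c, hcH⟩, hc⟩ := H.ne_bot_iff_exists_ne_one.1 hH
  have hmem : ∀ x, x * c ∈ H ↔ x ∈ H := fun x => H.mul_mem_cancel_right hcH
  let φ : Equiv.Perm G :=
    { toFun := fun x => if x ∈ H then x else x * c
      invFun := fun x => if x ∈ H then x else x * c⁻¹
      left_inv := fun x => by by_cases hx : x ∈ H <;> simp [hx, hmem]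
      right_inv := fun x => by
        by_cases hx : x ∈ H <;> simp [hx, H.mul_mem_cancel_right (inv_mem hcH)] }
  have hφ_mem : ∀ {x}, x ∈ H → φ x = x := fun hx => if_pos hx
  have hφ_notMem : ∀ {x}, x ∉ H → φ x = x * c := fun hx => if_neg hx
  have hcross : ∀ {x y}, ¬ (x ∈ H ↔ y ∈ H) → y * x⁻¹ ∉ S := fun hxy hS' => hxy
    ⟨fun hx => (H.mul_mem_cancel_right (inv_mem hx)).1 (hSH hS'),
      fun hy => inv_mem_iff.1 ((H.mul_mem_cancel_left hy).1 (hSH hS'))⟩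
  have hφH : ∀ x, φ x ∈ H ↔ x ∈ H := fun x => by
    by_cases hx : x ∈ H
    · rw [hφ_mem hx]
    · rw [hφ_notMem hx, hmem]
  have hφ : φ ∈ digraphAut (cayley S) := mem_digraphAut_cayley.2 fun x y => by
    by_cases hxy : x ∈ H ↔ y ∈ H
    · by_cases hx : x ∈ H
      · rw [hφ_mem hx, hφ_mem (hxy.1 hx)]
      · rw [hφ_notMem hx, hφ_notMem fun hy => hx (hxy.2 hy), mul_inv_rev, mul_assoc,
          mul_inv_cancel_left]
    · exact iff_of_false (hcross (by rwa [hφH, hφH])) (hcross hxy)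
  by_contra hne
  obtain ⟨x, -, hx⟩ := SetLike.exists_of_lt (lt_top_iff_ne_top.2 hne)
  have hfix := mem_fixedSubgroup.1 (hS ▸ Subgroup.mem_top x) φ hφ (hφ_mem (one_mem H))
  rw [hφ_notMem hx, mul_eq_left] at hfix
  exact hc (Subtype.ext hfix)

theorem not_admitsORR_of_isGeneralizedDihedral (hD : IsGeneralizedDihedral G)
    (hcard : Nat.card G ≠ 2) : ¬ AdmitsORR G := by
  obtain ⟨A, -, hA, τ, hτ, hτ2, hinv⟩ := hD
  rw [admitsORR_iff]
  rintro ⟨S, hS, hfix⟩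
  have hSA : S ⊆ A := fun g hg => by
    by_contra hgA
    have hgτ : g * τ ∈ A := (Subgroup.mul_mem_iff_of_index_two hA).2 (iff_of_false hgA hτ)
    have hconj := hinv _ hgτ
    rw [mul_inv_rev, mul_assoc τ⁻¹, mul_assoc g, ← pow_two, hτ2, mul_one] at hconj
    refine hS g hg g hg ?_
    nth_rewrite 1 [mul_left_cancel hconj]
    exact inv_mul_cancel g
  have hbot : A ≠ ⊥ := fun h => hcard (by rw [← Subgroup.index_bot, ← h, hA])
  exact hτ (eq_top_of_fixedSubgroup_eq_top hfix hSA hbot ▸ Subgroup.mem_top τ)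

end GeneralizedDihedral

section Pairs

variable {G : Type*} [Group G] {x y z : G}

namespace IsMinTriple

theorem mul_self_ne (h : IsMinTriple x y z) {t : G} (ht : x ∈ Subgroup.closure {y, t}) :
    z * z ≠ t := by
  rintro rfl
  have hle : Subgroup.closure {y, z * z} ≤ Subgroup.closure {y, z} :=
    closure_pair_le (mem_closure_pair_left y z)
      (mul_mem (mem_closure_pair_right y z) (mem_closure_pair_right y z))
  exact h.swap₁₂.swap₂₃.notMem_closure_pair (hle ht)

theorem admitsORR_of_rigid {ι : Type*} {e : ι → G} (h : IsMinTriple x y z) (hz : z ^ 2 ≠ 1)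
    (he : Function.Injective e) (hmem : ∀ i, e i ∈ Subgroup.closure {x, y}) (I : Set ι)
    (hI : Subgroup.closure {x, y} ≤ Subgroup.closure (e '' I)) (hinv : ∀ i j, e i * e j ≠ 1)
    (hzz : ∀ i, z * z ≠ e i) (R : ι → ι → Bool) (hR : ∀ i j, ArcOn e i j ↔ R i j)
    (hrigid : ∀ σ : Equiv.Perm (Option ι),
      (∀ a b, isolated R (σ a) (σ b) = isolated R a b) → ∀ i ∈ I, σ (some i) = some i) :
    AdmitsORR G := by
  have hle : Subgroup.closure (Set.range e) ≤ Subgroup.closure {x, y} :=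
    (Subgroup.closure_le _).2 (Set.range_subset_iff.2 hmem)
  have hge : Subgroup.closure {x, y} ≤ Subgroup.closure (insert z (Set.range e)) :=
    hI.trans (Subgroup.closure_mono ((Set.image_subset_range e I).trans (Set.subset_insert z _)))
  refine ORR.admitsORR_of_rigid I R he (fun hz => h.notMem_closure_pair (hle hz)) ?_
    (fun i => hI (hmem i)) hinv (by rwa [← pow_two]) hzz hR hrigid
  exact h.generates.eq_top (hge (mem_closure_pair_left x y)) (hge (mem_closure_pair_right x y))
    (Subgroup.subset_closure (Set.mem_insert z _))

end IsMinTriple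

/-- No cyclic subgroup contains two members of the family. -/
def PairwiseNoncyclic {ι : Type*} (e : ι → G) : Prop :=
  ∀ i j, i ≠ j → ∀ g, e i ∈ Subgroup.zpowers g → e j ∉ Subgroup.zpowers g

namespace PairwiseNoncyclic

variable {ι : Type*} {e : ι → G}

theorem injective (hcyc : PairwiseNoncyclic e) : Function.Injective e := fun i j hij => by
  by_contra hne
  exact hcyc i j hne (e j) (hij ▸ Subgroup.mem_zpowers _) (Subgroup.mem_zpowers _)

theorem mul_ne_one (hcyc : PairwiseNoncyclic e) (he : ∀ i, e i ^ 2 ≠ 1) (i j : ι) :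
    e i * e j ≠ 1 := by
  intro h
  by_cases hij : i = j
  · exact he i (by rw [pow_two]; nth_rw 2 [hij]; exact h)
  · refine hcyc i j hij (e i) (Subgroup.mem_zpowers _) ?_
    rw [← inv_eq_of_mul_eq_one_right h]
    exact inv_mem (Subgroup.mem_zpowers _)

theorem ne_of_mul_eq (hcyc : PairwiseNoncyclic e) (he : ∀ i, e i ^ 2 ≠ 1) {i j k : ι}
    (h : e k * e i = e j) : k ≠ i ∧ i ≠ j ∧ j ≠ k := by
  have hne : ∀ i, e i ≠ 1 := fun i hi => he i (by rw [hi, one_pow])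
  refine ⟨?_, fun hij => ?_, fun hjk => ?_⟩
  · rintro rfl
    refine hcyc k j (fun hkj => hne k ?_) (e k) (Subgroup.mem_zpowers _) ?_
    · rwa [← hkj, mul_eq_left] at h
    · exact h ▸ mul_mem (Subgroup.mem_zpowers _) (Subgroup.mem_zpowers _)
  · exact hne k (by rwa [hij, mul_eq_right] at h)
  · exact hne i (by rwa [hjk, mul_eq_left] at h)

end PairwiseNoncyclic

/-- The elements `x`, `y` and `y * x⁻¹`. -/
def quotientTriple (x y : G) : Fin 3 → G := ![x, y, y * x⁻¹]

theorem quotientTriple_mem (i : Fin 3) : quotientTriple x y i ∈ Subgroup.closure {x, y} := by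
  have hx := mem_closure_pair_left x y
  have hy := mem_closure_pair_right x y
  fin_cases i
  exacts [hx, hy, mul_mem hy (inv_mem hx)]

theorem IsMinTriple.pairwiseNoncyclic_quotientTriple (h : IsMinTriple x y z) :
    PairwiseNoncyclic (quotientTriple x y) := by
  intro i j hij g hi hj
  have hxy : ¬ (x ∈ Subgroup.zpowers g ∧ y ∈ Subgroup.zpowers g) := fun ⟨hx, hy⟩ =>
    h.notMem_zpowers hx hy
  have hx : y ∈ Subgroup.zpowers g → (y * x⁻¹ ∈ Subgroup.zpowers g ↔ x ∈ Subgroup.zpowers g) :=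
    fun hy => by rw [Subgroup.mul_mem_cancel_left _ hy, inv_mem_iff]
  have hy : x ∈ Subgroup.zpowers g → (y * x⁻¹ ∈ Subgroup.zpowers g ↔ y ∈ Subgroup.zpowers g) :=
    fun hx => Subgroup.mul_mem_cancel_right _ (inv_mem hx)
  fin_cases i <;> fin_cases j <;>
    simp only [quotientTriple, Fin.mk_zero, Fin.mk_one, Fin.reduceFinMk, Matrix.cons_val,
      ne_eq, not_true_eq_false] at hi hj hij <;> tauto

/-- The arcs among `x`, `y` and `y * x⁻¹`, where `A` and `B` say whether `x * y = y * x⁻¹` and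
`x ^ 2 = y ^ 2`. -/
def pairRel (A B : Bool) : Fin 3 → Fin 3 → Bool :=
  ![![false, true, false], ![false, false, A], ![B, false, false]]

theorem pairRel_rigid : ∀ A B : Bool, (A && B) = false → ∀ σ : Equiv.Perm (Option (Fin 3)),
    (∀ a b, isolated (pairRel A B) (σ a) (σ b) = isolated (pairRel A B) a b) →
    ∀ i ∈ ({0, 1} : Set (Fin 3)), σ (some i) = some i := by
  decide +kernel

theorem IsMinTriple.arcOn_quotientTriple [DecidableEq G] (h : IsMinTriple x y z)
    (he : ∀ i, quotientTriple x y i ^ 2 ≠ 1) (hxy : ¬ Commute x y) (i j : Fin 3) :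
    ArcOn (quotientTriple x y) i j ↔
      pairRel (decide (x * y = y * x⁻¹)) (decide (x ^ 2 = y ^ 2)) i j := by
  have hx : x ^ 2 ≠ 1 := he 0
  have hp : (y * x⁻¹) ^ 2 ≠ 1 := he 2
  rw [pow_two] at hx hp
  have hyx : y * x ≠ y * x⁻¹ := fun h => hx (eq_inv_iff_mul_eq_one.1 (mul_left_cancel h))
  have hpy : y * x⁻¹ * y ≠ x := fun h => hp (by rw [← mul_assoc, h, mul_inv_cancel])
  have hxp : x * (y * x⁻¹) ≠ y := fun h => hxy (by rwa [← mul_assoc, mul_inv_eq_iff_eq_mul] at h)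
  have hyp : y * (y * x⁻¹) = x ↔ x ^ 2 = y ^ 2 := by
    rw [← mul_assoc, mul_inv_eq_iff_eq_mul, eq_comm, pow_two, pow_two]
  constructor
  · rintro ⟨k, hk⟩
    obtain ⟨hki, hij, hjk⟩ := h.pairwiseNoncyclic_quotientTriple.ne_of_mul_eq he hk
    fin_cases i <;> fin_cases j <;> fin_cases k <;> simp_all [quotientTriple, pairRel]
  · intro hR
    fin_cases i <;> fin_cases j <;> simp only [pairRel, Fin.mk_zero, Fin.mk_one, Fin.reduceFinMk,
      Matrix.cons_val, Bool.false_eq_true, decide_eq_true_eq] at hR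
    · exact ⟨2, inv_mul_cancel_right y x⟩
    · exact ⟨0, hR⟩
    · exact ⟨1, hyp.2 hR⟩

theorem IsMinTriple.admitsORR_of_not_commute (h : IsMinTriple x y z) (hx : x ^ 2 ≠ 1)
    (hy : y ^ 2 ≠ 1) (hp : (y * x⁻¹) ^ 2 ≠ 1) (hz : z ^ 2 ≠ 1) (hxy : ¬ Commute x y)
    (hq : ¬ (x * y = y * x⁻¹ ∧ x ^ 2 = y ^ 2)) : AdmitsORR G := by
  classical
  have he : ∀ i, quotientTriple x y i ^ 2 ≠ 1 := fun i => by fin_cases i <;> assumption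
  have hcyc := h.pairwiseNoncyclic_quotientTriple
  refine h.admitsORR_of_rigid hz hcyc.injective quotientTriple_mem {0, 1}
    (by rw [Set.image_pair]; rfl) (hcyc.mul_ne_one he) (fun i => ?_) _
    (h.arcOn_quotientTriple he hxy) (pairRel_rigid _ _ (by simpa using hq))
  have hp : y ∈ Subgroup.closure {x, y * x⁻¹} := by
    simpa using mul_mem (mem_closure_pair_right x (y * x⁻¹)) (mem_closure_pair_left x (y * x⁻¹))
  fin_cases i
  exacts [h.mul_self_ne (mem_closure_pair_right y x),
    h.swap₁₂.mul_self_ne (mem_closure_pair_right x y), h.swap₁₂.mul_self_ne hp]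

end Pairs

section Words

variable {G : Type*} [Group G] {x y z : G}

/-- The product of powers of `x` and `y` with the given pair of exponents. -/
def zpowProd (x y : G) (v : ℤ × ℤ) : G := x ^ v.1 * y ^ v.2

theorem zpowProd_eq_iff {v w : ℤ × ℤ} :
    zpowProd x y v = zpowProd x y w ↔ zpowProd x y (v - w) = 1 := by
  have hsub : zpowProd x y (v - w) = (x ^ w.1)⁻¹ * zpowProd x y v * (y ^ w.2)⁻¹ := by
    simp only [zpowProd, Prod.fst_sub, Prod.snd_sub, zpow_sub, sub_eq_neg_add v.1, zpow_add,
      zpow_neg, mul_assoc]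
  rw [hsub, mul_inv_eq_one, inv_mul_eq_iff_eq_mul, zpowProd, zpowProd]

theorem zpowProd_mem (v : ℤ × ℤ) : zpowProd x y v ∈ Subgroup.closure {x, y} :=
  mul_mem (zpow_mem (mem_closure_pair_left x y) _) (zpow_mem (mem_closure_pair_right x y) _)

theorem IsMinTriple.mul_self_ne_zpowProd (h : IsMinTriple x y z) (m : ℤ) :
    z * z ≠ zpowProd x y (m, 1) := by
  refine h.swap₁₂.mul_self_ne ?_
  simpa [zpowProd] using mul_mem (inv_mem (zpow_mem (mem_closure_pair_left x (x ^ m * y)) m))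
    (mem_closure_pair_right x (x ^ m * y))

/-- A form of `IsMinTriple.admitsORR_of_rigid` in which everything about the multiplication is
expressed through exponents: the words in `E` are known to be nontrivial, those in `U` are known to
be trivial, and these two kinds decide all equations between the members of the connection set. -/
theorem IsMinTriple.admitsORR_of_words (h : IsMinTriple x y z) (hz : z ^ 2 ≠ 1) {n : ℕ}
    {e : Fin n → ℤ × ℤ} {m : Fin n → Fin n → ℤ × ℤ} {E U : ℤ × ℤ → Prop} [DecidablePred U]
    {a b : Fin n} (ha : e a = (1, 0)) (hb : e b = (0, 1))
    (hm : ∀ i j, zpowProd x y (e i) * zpowProd x y (e j) = zpowProd x y (m i j))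
    (hE : ∀ v, E v → zpowProd x y v ≠ 1) (hU : ∀ v, U v → zpowProd x y v = 1)
    (hinj : ∀ i j, i ≠ j → E (e i - e j)) (hinv : ∀ i j, E (m i j))
    (htable : ∀ i j k, E (m k i - e j) ∨ U (m k i - e j)) (hzz : ∀ i, z * z ≠ zpowProd x y (e i))
    (hrigid : ∀ σ : Equiv.Perm (Option (Fin n)),
      (∀ s t, isolated (fun i j => decide (∃ k, U (m k i - e j))) (σ s) (σ t) =
        isolated (fun i j => decide (∃ k, U (m k i - e j))) s t) →
      ∀ i, i = a ∨ i = b → σ (some i) = some i) :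
    AdmitsORR G := by
  refine h.admitsORR_of_rigid (e := fun i => zpowProd x y (e i)) hz (fun i j hij => ?_)
    (fun i => zpowProd_mem _) {a, b} ?_ (fun i j => ?_) hzz _ (fun i j => ?_) hrigid
  · by_contra hne
    exact hE _ (hinj i j hne) (zpowProd_eq_iff.1 hij)
  · simp [Set.image_pair, ha, hb, zpowProd]
  · rw [hm]
    exact hE _ (hinv i j)
  · simp only [ArcOn, hm, zpowProd_eq_iff, decide_eq_true_eq]
    exact exists_congr fun k =>
      ⟨fun hk => (htable i j k).resolve_left fun hEk => hE _ hEk hk, hU _⟩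

end Words

section Commuting

variable {G : Type*} [Group G] {x y z : G}

theorem zpowProd_mul_of_commute (hxy : Commute x y) (v w : ℤ × ℤ) :
    zpowProd x y v * zpowProd x y w = zpowProd x y (v + w) := by
  simp only [zpowProd, Prod.fst_add, Prod.snd_add, zpow_add]
  exact (hxy.zpow_zpow w.1 v.2).symm.mul_mul_mul_comm _ _

theorem zpowProd_zpow_of_commute (hxy : Commute x y) (v : ℤ × ℤ) (k : ℤ) :
    zpowProd x y v ^ k = zpowProd x y (k • v) := by
  simp only [zpowProd, (hxy.zpow_zpow v.1 v.2).mul_zpow, Prod.smul_fst, Prod.smul_snd, smul_eq_mul,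
    zpow_mul']

/-- A pair of coprime exponents is a row of an invertible matrix, and if its product of powers were
trivial then the other row would give a common root of `x` and `y`. -/
theorem IsMinTriple.zpowProd_ne_one (h : IsMinTriple x y z) (hxy : Commute x y) {v : ℤ × ℤ}
    (hv : IsCoprime v.1 v.2) : zpowProd x y v ≠ 1 := by
  intro h1
  obtain ⟨p, q, hpq⟩ := hv
  have hroot : ∀ k l : ℤ,
      zpowProd x y (k • v + l • (q, -p)) ∈ Subgroup.zpowers (zpowProd x y (q, -p)) := by
    intro k l
    rw [← zpowProd_mul_of_commute hxy, ← zpowProd_zpow_of_commute hxy,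
      ← zpowProd_zpow_of_commute hxy, h1, one_zpow, one_mul]
    exact Subgroup.zpow_mem_zpowers _ l
  have hx := hroot p v.2
  have hy := hroot q (-v.1)
  rw [show p • v + v.2 • (q, -p) = (1, 0) by ext <;> simp <;> linarith] at hx
  rw [show q • v + (-v.1) • (q, -p) = (0, 1) by ext <;> simp <;> linarith] at hy
  exact h.notMem_zpowers (by simpa [zpowProd] using hx) (by simpa [zpowProd] using hy)

/-- The exponents of the elements `x`, `y`, `x * y`, `x ^ 2 * y`. -/
def abelianExp : Fin 4 → ℤ × ℤ := ![(1, 0), (0, 1), (1, 1), (2, 1)]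

/-- The pairs of exponents for which `IsMinTriple.admitsORR_of_commute` excludes that
`x ^ a * y ^ b = 1`. -/
def AbelianExcluded (v : ℤ × ℤ) : Prop :=
  Int.gcd v.1 v.2 = 1 ∨ ∃ w ∈ [(2, 0), (0, 2), (2, 2), (4, 2), (3, 0)], v = w ∨ v = -w

instance : DecidablePred AbelianExcluded := fun v => by unfold AbelianExcluded; infer_instance

theorem abelianExp_rigid : ∀ σ : Equiv.Perm (Option (Fin 4)),
    (∀ s t, isolated (fun i j => decide (∃ k, abelianExp k + abelianExp i - abelianExp j = 0))
        (σ s) (σ t) =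
      isolated (fun i j => decide (∃ k, abelianExp k + abelianExp i - abelianExp j = 0)) s t) →
    ∀ i, i = 0 ∨ i = 1 → σ (some i) = some i := by
  decide +kernel

theorem abelianExcluded_table : ∀ i j k,
    AbelianExcluded (abelianExp k + abelianExp i - abelianExp j) ∨
      abelianExp k + abelianExp i - abelianExp j = 0 := by decide

theorem IsMinTriple.admitsORR_of_commute (h : IsMinTriple x y z) (hz : z ^ 2 ≠ 1)
    (hxy : Commute x y) (hx : x ^ 2 ≠ 1) (hx3 : x ^ 3 ≠ 1) (hy : y ^ 2 ≠ 1)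
    (hxy2 : (x * y) ^ 2 ≠ 1) (hxxy : (x ^ 2 * y) ^ 2 ≠ 1) : AdmitsORR G := by
  have hlist : ∀ w ∈ [((2 : ℤ), (0 : ℤ)), (0, 2), (2, 2), (4, 2), (3, 0)],
      zpowProd x y w ≠ 1 := by
    rw [hxy.mul_pow] at hxy2
    rw [(hxy.pow_left 2).mul_pow, ← pow_mul] at hxxy
    simp only [List.forall_mem_cons, zpowProd, zpow_zero, one_mul, mul_one]
    exact ⟨mod_cast hx, mod_cast hy, mod_cast hxy2, mod_cast hxxy, mod_cast hx3,
      List.forall_mem_nil _⟩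
  refine h.admitsORR_of_words (U := (· = 0)) (E := AbelianExcluded) hz (a := 0) (b := 1) rfl rfl
    (fun i j => zpowProd_mul_of_commute hxy (abelianExp i) (abelianExp j)) ?_ ?_ (by decide)
    (by decide) abelianExcluded_table ?_ abelianExp_rigid
  · rintro v (hv | ⟨w, hw, rfl | rfl⟩)
    · exact h.zpowProd_ne_one hxy (Int.isCoprime_iff_gcd_eq_one.2 hv)
    · exact hlist v hw
    · rw [← neg_one_smul ℤ, ← zpowProd_zpow_of_commute hxy, zpow_neg_one, inv_ne_one]
      exact hlist w hw
  · rintro _ rfl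
    simp [zpowProd]
  · intro i
    fin_cases i
    · simpa [zpowProd, abelianExp] using h.mul_self_ne (mem_closure_pair_right y x)
    all_goals exact h.mul_self_ne_zpowProd _

theorem IsMinTriple.sq_eq_one_or_of_commute (hO : ¬ AdmitsORR G) (h : IsMinTriple x y z)
    (hz : z ^ 2 ≠ 1) (hxy : Commute x y) (hx : x ^ 2 ≠ 1) (hx3 : x ^ 3 ≠ 1) :
    y ^ 2 = 1 ∨ (x * y) ^ 2 = 1 ∨ (x ^ 2 * y) ^ 2 = 1 := by
  by_contra! hne
  exact hO (h.admitsORR_of_commute hz hxy hx hx3 hne.1 hne.2.1 hne.2.2)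

theorem IsMinTriple.pow_three_eq_one_of_commute (hO : ¬ AdmitsORR G) (h : IsMinTriple x y z)
    (hz : z ^ 2 ≠ 1) (hxy : Commute x y) (hx : x ^ 3 = 1) : y ^ 3 = 1 := by
  by_contra hy
  have hne : ∀ a b : ℕ, IsCoprime (a : ℤ) b → y ^ a * x ^ b ≠ 1 := fun a b hab => by
    simpa [zpowProd] using h.swap₁₂.zpowProd_ne_one hxy.symm (v := (a, b)) hab
  have hx5 : x ^ 5 = x ^ 2 := by rw [show 5 = 3 + 2 from rfl, pow_add, hx, one_mul]
  have hy2 : y ^ 2 ≠ 1 := fun h2 => hne 2 3 (by norm_num) (by rw [h2, hx, mul_one])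
  rcases h.swap₁₂.sq_eq_one_or_of_commute hO hz hxy.symm hy2 hy with h2 | h2 | h2
  · exact hne 0 1 (by norm_num) (by simpa [pow_succ x 2, h2] using hx)
  · rw [hxy.symm.mul_pow, ← hx5] at h2
    exact hne 2 5 (by norm_num) h2
  · rw [(hxy.symm.pow_left 2).mul_pow, ← hx5, ← pow_mul] at h2
    exact hne 4 5 (by norm_num) h2

theorem IsMinTriple.pow_eq_one_of_commute_of_involution (hO : ¬ AdmitsORR G)
    (h : IsMinTriple x y z) (hz : z ^ 2 ≠ 1) (hxy : Commute x y) (hx : x ^ 2 ≠ 1)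
    (hx3 : x ^ 3 ≠ 1) (hy : y ^ 2 = 1) : x ^ 4 = 1 ∨ x ^ 6 = 1 := by
  have hsq : ∀ k : ℕ, (x ^ k * y) ^ 2 = x ^ (2 * k) := fun k => by
    rw [(hxy.pow_left k).mul_pow, hy, mul_one, ← pow_mul, mul_comm]
  have hxy' : IsMinTriple x (x * y) z := by simpa [hxy.eq] using h.mul_pow₂ 1
  rcases hxy'.sq_eq_one_or_of_commute hO hz ((Commute.refl x).mul_right hxy) hx hx3 with h | h | h
  · exact absurd (by simpa [h] using (hsq 1).symm) hx
  · rw [← mul_assoc, ← pow_two, hsq] at h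
    exact Or.inl h
  · rw [← mul_assoc, ← pow_succ, hsq] at h
    exact Or.inr h

theorem IsMinTriple.commute_cases (hD : ¬ IsGeneralizedDihedral G) (hO : ¬ AdmitsORR G)
    (h : IsMinTriple x y z) (hxy : Commute x y) (hx : x ^ 2 ≠ 1) :
    (x ^ 3 = 1 ∧ y ^ 3 = 1) ∨ (x ^ 4 = 1 ∧ y ^ 4 = 1) ∨
      (x ^ 6 = 1 ∧ x ^ 3 ≠ 1 ∧ ∃ j : ℕ, (y * x ^ j) ^ 2 = 1) := by
  obtain ⟨w, hw, hw2⟩ := h.exists_sq_ne_one hD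
  by_cases hx3 : x ^ 3 = 1
  · exact Or.inl ⟨hx3, hw.pow_three_eq_one_of_commute hO hw2 hxy hx3⟩
  obtain ⟨j, hj⟩ : ∃ j : ℕ, (y * x ^ j) ^ 2 = 1 := by
    rcases hw.sq_eq_one_or_of_commute hO hw2 hxy hx hx3 with h | h | h
    · exact ⟨0, by simpa using h⟩
    · exact ⟨1, by rwa [pow_one, ← hxy.eq]⟩
    · exact ⟨2, by rwa [← (hxy.pow_left 2).eq]⟩
  have hcomm : Commute x (y * x ^ j) := hxy.mul_right ((Commute.refl x).pow_right j)
  rcases (hw.mul_pow₂ j).pow_eq_one_of_commute_of_involution hO hw2 hcomm hx hx3 hj with hx4 | hx6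
  · refine Or.inr (Or.inl ⟨hx4, ?_⟩)
    have hxj : ((x ^ j) ^ 2) ^ 2 = 1 := by
      rw [← pow_mul, ← pow_mul, mul_comm j, mul_comm, pow_mul', hx4, one_pow]
    rw [(hxy.symm.pow_right j).mul_pow] at hj
    rw [show 4 = 2 * 2 from rfl, pow_mul, eq_inv_of_mul_eq_one_left hj, inv_pow, hxj, inv_one]
  · exact Or.inr (Or.inr ⟨hx6, hx3, j, hj⟩)

end Commuting

section Twisted

variable {G : Type*} [Group G] {x y z : G}

/-- The relations `(y * x) ^ 2 = 1` and `(y * x⁻¹) ^ 2 = 1`. In other words, conjugation by `y`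
takes `x` to `x⁻¹ * y⁻²` and, consequently, inverts `x ^ 2`. -/
structure IsTwistedPair (x y : G) : Prop where
  mul_sq : (y * x) ^ 2 = 1
  mul_inv_sq : (y * x⁻¹) ^ 2 = 1

namespace IsTwistedPair

theorem inv_left (h : IsTwistedPair x y) : IsTwistedPair x⁻¹ y :=
  ⟨h.mul_inv_sq, by simpa using h.mul_sq⟩

theorem symm (h : IsTwistedPair x y) : IsTwistedPair y x where
  mul_sq := by
    have : (x * y) ^ 2 = x * (y * x) ^ 2 * x⁻¹ := by rw [pow_two, pow_two]; group
    rw [this, h.mul_sq, mul_one, mul_inv_cancel]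
  mul_inv_sq := by
    have : (x * y⁻¹) ^ 2 = ((y * x⁻¹) ^ 2)⁻¹ := by rw [pow_two, pow_two]; group
    rw [this, h.mul_inv_sq, inv_one]

theorem mul_eq (h : IsTwistedPair x y) : y * x = x⁻¹ * y⁻¹ := by
  rw [← mul_inv_rev, eq_inv_iff_mul_eq_one, ← pow_two, h.mul_sq]

theorem semiconjBy_sq (h : IsTwistedPair x y) : SemiconjBy y (x ^ 2) (x ^ 2)⁻¹ := by
  have hinv : y⁻¹ * x = x⁻¹ * y := by
    rw [inv_mul_eq_iff_eq_mul, ← mul_assoc, h.inv_left.mul_eq, inv_inv, inv_mul_cancel_right]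
  rw [SemiconjBy, pow_two, ← mul_assoc, h.mul_eq, mul_assoc, hinv, mul_inv_rev, mul_assoc]

theorem mul_zpow_of_even (h : IsTwistedPair x y) {m : ℤ} (hm : Even m) :
    y * x ^ m = x ^ (-m) * y := by
  obtain ⟨k, rfl⟩ := hm
  have := (h.semiconjBy_sq.zpow_right k).eq
  rwa [inv_zpow', ← zpow_natCast, ← zpow_mul, ← zpow_mul, Nat.cast_ofNat, mul_neg, two_mul] at this

theorem mul_zpow_of_odd (h : IsTwistedPair x y) {m : ℤ} (hm : Odd m) :
    y * x ^ m = x ^ (-m) * y⁻¹ := by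
  obtain ⟨k, rfl⟩ := hm
  rw [zpow_add_one, ← mul_assoc, h.mul_zpow_of_even (even_two_mul k), mul_assoc, h.mul_eq,
    ← mul_assoc, ← zpow_sub_one]
  congr 2
  ring

theorem commute_sq (h : IsTwistedPair x y) (hx : x ^ 4 = 1) : Commute (x ^ 2) y := by
  have hinv : (x ^ 2)⁻¹ = x ^ 2 := inv_eq_self_of_sq_eq_one (by rw [← pow_mul, hx])
  have := h.semiconjBy_sq
  rw [hinv] at this
  exact Commute.symm this

theorem zpow_ne_one_of_odd (h : IsTwistedPair x y) (hy : y ^ 2 ≠ 1) {m : ℤ} (hm : Odd m) :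
    x ^ m ≠ 1 := by
  intro hxm
  have := h.mul_zpow_of_odd hm
  rw [zpow_neg, hxm, inv_one, one_mul, mul_one, eq_inv_iff_mul_eq_one, ← pow_two] at this
  exact hy this

theorem sq_ne_zpow (h : IsTwistedPair x y) (hy : y ^ 2 ≠ 1) (hx : x ^ 4 ≠ 1) {m : ℤ}
    (hm : Odd m ∨ m = 0 ∨ m = 2 ∨ m = -2) : y ^ 2 ≠ x ^ m := by
  intro hxm
  have hcomm : y * x ^ m = x ^ m * y := hxm ▸ ((Commute.refl y).pow_right 2).eq
  have heven : Even m → x ^ (2 * m) = 1 := fun hm => by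
    rw [h.mul_zpow_of_even hm] at hcomm
    rw [two_mul, zpow_add, ← eq_inv_iff_mul_eq_one, ← zpow_neg, mul_right_cancel hcomm]
  rcases hm with hm | rfl | rfl | rfl
  · refine h.zpow_ne_one_of_odd hy (m := m + (m + m)) (by simp [hm, parity_simps]) ?_
    rw [h.mul_zpow_of_odd hm, zpow_neg, ← mul_inv_rev, inv_eq_iff_mul_eq_one] at hcomm
    rw [zpow_add, zpow_add, ← mul_assoc, ← hcomm, ← hxm]
    simp only [pow_two, mul_assoc]
  · exact hy (by rw [hxm, zpow_zero])
  · exact hx (mod_cast heven even_two)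
  · exact hx (by simpa using heven (by decide))

end IsTwistedPair

/-- The exponents of the elements `x`, `x ^ 2`, `y`, `x ^ 2 * y`. -/
def twistedExp : Fin 4 → ℤ × ℤ := ![(1, 0), (2, 0), (0, 1), (2, 1)]

/-- The exponents of the product of two words `x ^ a * y ^ b` with exponents `v` and `w`, when `x`
and `y` form a twisted pair and `y` has exponent `0` or `1` in the first word. -/
def twistedMul (v w : ℤ × ℤ) : ℤ × ℤ :=
  if v.2 = 0 then v + w else if Even w.1 then (v.1 - w.1, v.2 + w.2) else (v.1 - w.1, w.2 - v.2)

theorem IsTwistedPair.zpowProd_mul (h : IsTwistedPair x y) {v : ℤ × ℤ} (hv : v.2 = 0 ∨ v.2 = 1)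
    (w : ℤ × ℤ) : zpowProd x y v * zpowProd x y w = zpowProd x y (twistedMul v w) := by
  obtain ⟨a, b⟩ := v
  obtain ⟨c, d⟩ := w
  rcases hv with rfl | rfl
  · simp [zpowProd, twistedMul, zpow_add, mul_assoc]
  have hassoc : zpowProd x y (a, 1) * zpowProd x y (c, d) = x ^ a * (y * x ^ c) * y ^ d := by
    simp only [zpowProd, zpow_one, mul_assoc]
  rcases Int.even_or_odd c with hc | hc
  · rw [hassoc, h.mul_zpow_of_even hc]
    simp only [zpowProd, twistedMul, one_ne_zero, hc, if_true, if_false, sub_eq_add_neg, zpow_add,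
      zpow_one, mul_assoc]
  · rw [hassoc, h.mul_zpow_of_odd hc]
    simp only [zpowProd, twistedMul, one_ne_zero, Int.not_even_iff_odd.2 hc, if_false,
      sub_eq_neg_add d, sub_eq_add_neg a, zpow_add, zpow_neg_one, mul_assoc]

/-- The pairs of exponents for which `IsMinTriple.admitsORR_of_twisted` excludes that
`x ^ a * y ^ b = 1`, where `B` says whether `y ^ 2 = x ^ 4`. -/
def TwistedExcluded (B : Bool) (v : ℤ × ℤ) : Prop :=
  (v.2 = 1 ∨ v.2 = -1) ∨ (v.2 = 0 ∧ (Odd v.1 ∨ v.1 ∈ [2, -2, 4, -4])) ∨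
    ((v.2 = 2 ∨ v.2 = -2) ∧ (Odd v.1 ∨ v.1 ∈ [0, 2, -2])) ∨ (B = false ∧ v = (-4, 2))

/-- The pairs of exponents for which `x ^ a * y ^ b = 1` is known, where `B` says whether
`y ^ 2 = x ^ 4`. -/
def TwistedTrivial (B : Bool) (v : ℤ × ℤ) : Prop := v = 0 ∨ (B = true ∧ v = (-4, 2))

instance (B : Bool) : DecidablePred (TwistedExcluded B) := fun v => by
  unfold TwistedExcluded; infer_instance

instance (B : Bool) : DecidablePred (TwistedTrivial B) := fun v => by
  unfold TwistedTrivial; infer_instance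

theorem twistedExp_rigid : ∀ B : Bool, ∀ σ : Equiv.Perm (Option (Fin 4)),
    (∀ s t, isolated (fun i j => decide (∃ k,
        TwistedTrivial B (twistedMul (twistedExp k) (twistedExp i) - twistedExp j))) (σ s) (σ t) =
      isolated (fun i j => decide (∃ k,
        TwistedTrivial B (twistedMul (twistedExp k) (twistedExp i) - twistedExp j))) s t) →
    ∀ i, i = 0 ∨ i = 2 → σ (some i) = some i := by
  decide +kernel

theorem twistedExcluded_table : ∀ (B : Bool) (i j k : Fin 4),
    TwistedExcluded B (twistedMul (twistedExp k) (twistedExp i) - twistedExp j) ∨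
      TwistedTrivial B (twistedMul (twistedExp k) (twistedExp i) - twistedExp j) := by
  decide +kernel

theorem twistedExcluded_sub : ∀ (B : Bool) (i j : Fin 4), i ≠ j →
    TwistedExcluded B (twistedExp i - twistedExp j) := by
  decide +kernel

theorem twistedExcluded_mul : ∀ (B : Bool) (i j : Fin 4),
    TwistedExcluded B (twistedMul (twistedExp i) (twistedExp j)) := by
  decide +kernel

theorem zpowProd_eq_one_iff {v : ℤ × ℤ} : zpowProd x y v = 1 ↔ y ^ v.2 = x ^ (-v.1) := by
  simp [zpowProd, mul_eq_one_iff_inv_eq, eq_comm]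

theorem zpowProd_neg_four_two_eq_one_iff : zpowProd x y (-4, 2) = 1 ↔ y ^ 2 = x ^ 4 := by
  rw [zpowProd_eq_one_iff, neg_neg]
  change y ^ (2 : ℤ) = x ^ (4 : ℤ) ↔ _
  norm_cast

theorem IsMinTriple.zpowProd_ne_one_of_twistedExcluded (h : IsMinTriple x y z) (hx : x ^ 4 ≠ 1)
    (hy : y ^ 2 ≠ 1) (ht : IsTwistedPair x y) {B : Bool} (hB : B = false → y ^ 2 ≠ x ^ 4)
    {v : ℤ × ℤ} (hv : TwistedExcluded B v) : zpowProd x y v ≠ 1 := by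
  intro h1
  have hx2 : x ^ 2 ≠ 1 := fun h2 => hx (by rw [show 4 = 2 * 2 from rfl, pow_mul, h2, one_pow])
  have hv1 := zpowProd_eq_one_iff.1 h1
  obtain (hv2 | hv2) | ⟨hv2, hodd | hmem⟩ | ⟨hv2, hv'⟩ | ⟨hBf, rfl⟩ := hv
  · exact h.notMem_zpowers (Subgroup.mem_zpowers x) ⟨-v.1, by simpa [hv2] using hv1.symm⟩
  · exact h.notMem_zpowers (Subgroup.mem_zpowers x) ⟨v.1, by simpa [hv2] using hv1.symm⟩
  · exact ht.zpow_ne_one_of_odd hy hodd (by simpa [zpowProd, hv2] using h1)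
  · simp only [List.mem_cons, List.not_mem_nil, or_false] at hmem
    rcases hmem with h | h | h | h <;> simp [hv2, h] at hv1 <;> norm_cast at hv1
    exacts [hx2 hv1.symm, hx hv1.symm]
  · simp only [List.mem_cons, List.not_mem_nil, or_false] at hv'
    rcases hv2 with hv2 | hv2 <;> rw [hv2] at hv1
    · exact ht.sq_ne_zpow hy hx (by simpa [neg_eq_iff_eq_neg, or_comm] using hv') (mod_cast hv1)
    · rw [zpow_neg, zpow_neg, inv_inj] at hv1
      exact ht.sq_ne_zpow hy hx hv' (mod_cast hv1)
  · exact hB hBf (zpowProd_neg_four_two_eq_one_iff.1 h1)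

theorem IsMinTriple.admitsORR_of_twisted (h : IsMinTriple x y z) (hz : z ^ 2 ≠ 1)
    (hzx : z ^ 2 ≠ x ^ 2) (hx : x ^ 4 ≠ 1) (hy : y ^ 2 ≠ 1) (ht : IsTwistedPair x y) :
    AdmitsORR G := by
  classical
  refine h.admitsORR_of_words (e := twistedExp) (a := 0) (b := 2)
    (m := fun i j => twistedMul (twistedExp i) (twistedExp j))
    (E := TwistedExcluded (y ^ 2 = x ^ 4)) (U := TwistedTrivial (y ^ 2 = x ^ 4)) hz rfl rfl
    (fun i j => ht.zpowProd_mul (by revert i; decide) _)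
    (fun v hv => h.zpowProd_ne_one_of_twistedExcluded hx hy ht of_decide_eq_false hv) ?_
    (twistedExcluded_sub _) (twistedExcluded_mul _) (twistedExcluded_table _) ?_
    (twistedExp_rigid _)
  · rintro v (rfl | ⟨hB, rfl⟩)
    · simp [zpowProd]
    · exact zpowProd_neg_four_two_eq_one_iff.2 (by simpa using hB)
  · intro i
    fin_cases i
    · simpa [zpowProd, twistedExp] using h.mul_self_ne (mem_closure_pair_right y x)
    · simpa [zpowProd, twistedExp, pow_two] using hzx
    all_goals exact h.mul_self_ne_zpowProd _

theorem IsMinTriple.mul_pow_sq_eq_one_or (hO : ¬ AdmitsORR G) (h : IsMinTriple x y z)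
    (hz : z ^ 2 ≠ 1) (hx : x ^ 2 ≠ 1) (hxy : ¬ Commute x y)
    (hq : ¬ (x * y = y * x⁻¹ ∧ x ^ 2 = y ^ 2)) (n : ℕ) :
    (y * x ^ n) ^ 2 = 1 ∨ (y * x ^ n * x⁻¹) ^ 2 = 1 := by
  by_contra! hn
  refine hO ((h.mul_pow₂ n).admitsORR_of_not_commute hx hn.1 hn.2 hz (fun hc => hxy ?_) ?_)
  · simpa using hc.mul_right ((Commute.refl x).pow_right n).inv_right
  · rintro ⟨hinv, hsq⟩
    have hxy' : x * y = y * x⁻¹ := by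
      refine mul_right_cancel (b := x ^ n) ?_
      rw [mul_assoc, hinv, mul_assoc, mul_assoc, ((Commute.refl x).inv_left.pow_right n).eq]
    have hpow : x ^ n * y = y * (x ^ n)⁻¹ := by
      rw [← inv_pow]
      exact ((show SemiconjBy y x⁻¹ x from hxy'.symm).pow_right n).eq.symm
    exact hq ⟨hxy', by
      rw [hsq, pow_two, pow_two, mul_assoc, ← mul_assoc (x ^ n), hpow, inv_mul_cancel_right]⟩

theorem IsMinTriple.pow_four_eq_one_of_twisted (hO : ¬ AdmitsORR G) (h : IsMinTriple x y z)
    (hz : z ^ 2 ≠ 1) (hy : y ^ 2 ≠ 1) (ht : IsTwistedPair x y) : x ^ 4 = 1 := by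
  by_contra hx
  by_cases hzx : z ^ 2 = x ^ 2
  · refine hO (h.inv₁.admitsORR_of_twisted hz (fun hinv => hx ?_) (by simpa using hx) hy
      ht.inv_left)
    rw [hzx, inv_pow, eq_inv_iff_mul_eq_one, ← pow_add] at hinv
    exact hinv
  · exact hO (h.admitsORR_of_twisted hz hzx hx hy ht)

theorem IsMinTriple.pair_cases (hD : ¬ IsGeneralizedDihedral G) (hO : ¬ AdmitsORR G)
    (h : IsMinTriple x y z) (hx : x ^ 2 ≠ 1) :
    Commute x y ∨ (y ^ 2 = 1 ∧ x * y = y * x⁻¹) ∨ (x * y = y * x⁻¹ ∧ x ^ 2 = y ^ 2) ∨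
      (x ^ 4 = 1 ∧ y ^ 4 = 1 ∧ Commute (x ^ 2) y) := by
  obtain ⟨w, hw, hw2⟩ := h.exists_sq_ne_one hD
  by_cases hc : Commute x y
  · exact Or.inl hc
  by_cases hq : x * y = y * x⁻¹ ∧ x ^ 2 = y ^ 2
  · exact Or.inr (Or.inr (Or.inl hq))
  have hpow := hw.mul_pow_sq_eq_one_or hO hw2 hx hc hq
  have h0 : y ^ 2 = 1 ∨ (y * x⁻¹) ^ 2 = 1 := by simpa using hpow 0
  have h1 : (y * x) ^ 2 = 1 ∨ y ^ 2 = 1 := by simpa using hpow 1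
  have h2 : (y * x * x) ^ 2 = 1 ∨ (y * x) ^ 2 = 1 := by
    simpa [pow_two x, ← mul_assoc] using hpow 2
  by_cases hy : y ^ 2 = 1
  · by_cases hyx : (y * x) ^ 2 = 1
    · refine Or.inr (Or.inl ⟨hy, ?_⟩)
      rw [eq_mul_inv_iff_mul_eq, mul_assoc, ← inv_eq_self_of_sq_eq_one hyx, mul_inv_rev,
        mul_inv_cancel_left, inv_eq_self_of_sq_eq_one hy]
    · have ht : IsTwistedPair x (y * x) := ⟨h2.resolve_right hyx, by simpa using hy⟩
      have hw' : IsMinTriple x (y * x) w := by simpa using hw.mul_pow₂ 1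
      have hx4 := hw'.pow_four_eq_one_of_twisted hO hw2 hyx ht
      have hcomm := (ht.commute_sq hx4).mul_right ((Commute.refl x).pow_left 2).inv_right
      exact Or.inr (Or.inr (Or.inr ⟨hx4, by rw [show 4 = 2 * 2 from rfl, pow_mul, hy, one_pow],
        by simpa using hcomm⟩))
  · have ht : IsTwistedPair x y := ⟨h1.resolve_right hy, h0.resolve_left hy⟩
    have hx4 := hw.pow_four_eq_one_of_twisted hO hw2 hy ht
    exact Or.inr (Or.inr (Or.inr ⟨hx4,
      hw.swap₁₂.pow_four_eq_one_of_twisted hO hw2 hx ht.symm, ht.commute_sq hx4⟩))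

end Twisted

section CentralExtension

/-- The squares of three generators `x`, `y`, `z` and their commutators, defined by
`y * x = x * y * cyx`, `z * x = x * z * czx` and `z * y = y * z * czy`. -/
structure QuadData (Φ : Type*) where
  sx : Φ
  sy : Φ
  sz : Φ
  cyx : Φ
  czx : Φ
  czy : Φ

/-- The central extension of an elementary abelian group of order `8` by `Φ` in which three
generators have the squares and commutators prescribed by `d`: the normal form
`x ^ i * y ^ j * z ^ k * φ` is encoded by the quadruple `(i, j, k, φ)`. -/
@[ext] structure Quad {Φ : Type*} (d : QuadData Φ) where
  i : ZMod 2
  j : ZMod 2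
  k : ZMod 2
  φ : Φ

namespace Quad

variable {Φ : Type*} [Zero Φ] {d : QuadData Φ}

instance : One (Quad d) := ⟨⟨0, 0, 0, 0⟩⟩

theorem one_def : (1 : Quad d) = ⟨0, 0, 0, 0⟩ := rfl

end Quad

variable {Φ : Type*} [AddCommGroup Φ] [Module (ZMod 2) Φ] {d : QuadData Φ}

/-- The bilinear cocycle that defines the multiplication of `Quad d`. -/
def QuadData.cocycle (d : QuadData Φ) (a b : Quad d) : Φ :=
  (a.i * b.i) • d.sx + (a.j * b.j) • d.sy + (a.k * b.k) • d.sz + (a.j * b.i) • d.cyx +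
    (a.k * b.i) • d.czx + (a.k * b.j) • d.czy

namespace Quad

instance : Mul (Quad d) :=
  ⟨fun a b => ⟨a.i + b.i, a.j + b.j, a.k + b.k, a.φ + b.φ + d.cocycle a b⟩⟩

instance : Inv (Quad d) := ⟨fun a => ⟨-a.i, -a.j, -a.k, -a.φ + d.cocycle a a⟩⟩

theorem mul_def (a b : Quad d) :
    a * b = ⟨a.i + b.i, a.j + b.j, a.k + b.k, a.φ + b.φ + d.cocycle a b⟩ := rfl

theorem inv_def (a : Quad d) : a⁻¹ = ⟨-a.i, -a.j, -a.k, -a.φ + d.cocycle a a⟩ := rfl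

instance : Group (Quad d) := Group.ofLeftAxioms
  (fun a b c => by
    ext <;> simp only [mul_def, QuadData.cocycle, add_mul, mul_add, add_smul] <;> abel)
  (fun a => by ext <;> simp [mul_def, one_def, QuadData.cocycle])
  (fun a => by
    ext <;> simp only [mul_def, one_def, inv_def, QuadData.cocycle, neg_mul, neg_smul] <;> abel)

instance [DecidableEq Φ] : DecidableEq (Quad d) := fun a b =>
  decidable_of_iff (a.i = b.i ∧ a.j = b.j ∧ a.k = b.k ∧ a.φ = b.φ) Quad.ext_iff.symm

/-- The underlying set of `Quad d` as a product. -/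
def equivProd (d : QuadData Φ) : Quad d ≃ ZMod 2 × ZMod 2 × ZMod 2 × Φ where
  toFun a := (a.i, a.j, a.k, a.φ)
  invFun a := ⟨a.1, a.2.1, a.2.2.1, a.2.2.2⟩

instance [Fintype Φ] : Fintype (Quad d) := Fintype.ofEquiv _ (equivProd d).symm

end Quad

end CentralExtension

section Realization

variable {Φ : Type*} {G : Type*} [Group G] {x y z g h : G}

theorem zmod_two_eq_zero_or_one : ∀ i : ZMod 2, i = 0 ∨ i = 1 := by decide

theorem center_commute (a : Subgroup.center G) (g : G) : Commute (a : G) g :=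
  Subgroup.mem_center_iff.1 a.2 g |>.symm

variable [AddCommGroup Φ] {ι : Φ →+ Additive (Subgroup.center G)}

theorem toMul_mul_pow_val_mul (φ : Φ) (g : G) (i : ZMod 2) (w : G) :
    ((ι φ).toMul : G) * (g ^ i.val * w) = g ^ i.val * ((ι φ).toMul * w) :=
  (center_commute _ _).left_comm w

variable [Module (ZMod 2) Φ] {d : QuadData Φ} {s : Φ}

/-- The elements `x`, `y`, `z` have the squares and commutators prescribed by `d`, where `ι`
interprets `Φ` in the center of the group. -/
structure QuadData.IsRealizedBy (d : QuadData Φ) (ι : Φ →+ Additive (Subgroup.center G))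
    (x y z : G) : Prop where
  mul_self_x : x * x = (ι d.sx).toMul
  mul_self_y : y * y = (ι d.sy).toMul
  mul_self_z : z * z = (ι d.sz).toMul
  comm_yx : y * x = x * (y * (ι d.cyx).toMul)
  comm_zx : z * x = x * (z * (ι d.czx).toMul)
  comm_zy : z * y = y * (z * (ι d.czy).toMul)

theorem pow_val_mul_pow_val_mul (hg : g * g = (ι s).toMul) (i j : ZMod 2) (w : G) :
    g ^ i.val * (g ^ j.val * w) = g ^ (i + j).val * ((ι ((i * j) • s)).toMul * w) := by
  rw [← mul_assoc]
  rcases zmod_two_eq_zero_or_one i with rfl | rfl <;>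
    rcases zmod_two_eq_zero_or_one j with rfl | rfl <;>
    simp [ZMod.val_one, hg, show (1 + 1 : ZMod 2) = 0 from rfl]

theorem pow_val_mul_pow_val_mul_comm (hgh : h * g = g * (h * (ι s).toMul)) (i j : ZMod 2) (w : G) :
    h ^ j.val * (g ^ i.val * w) = g ^ i.val * (h ^ j.val * ((ι ((j * i) • s)).toMul * w)) := by
  rw [← mul_assoc]
  rcases zmod_two_eq_zero_or_one i with rfl | rfl <;>
    rcases zmod_two_eq_zero_or_one j with rfl | rfl <;>
    simp [ZMod.val_one, hgh, mul_assoc]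

namespace Quad

/-- The homomorphism from `Quad d` that evaluates normal forms in a realization of `d`. -/
def lift (hd : d.IsRealizedBy ι x y z) : Quad d →* G :=
  MonoidHom.mk' (fun a => x ^ a.i.val * (y ^ a.j.val * (z ^ a.k.val * (ι a.φ).toMul))) fun a b => by
    simp only [mul_def, mul_assoc, toMul_mul_pow_val_mul, pow_val_mul_pow_val_mul_comm hd.comm_yx,
      pow_val_mul_pow_val_mul_comm hd.comm_zx, pow_val_mul_pow_val_mul_comm hd.comm_zy,
      pow_val_mul_pow_val_mul hd.mul_self_x, pow_val_mul_pow_val_mul hd.mul_self_y,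
      pow_val_mul_pow_val_mul hd.mul_self_z, ← Subgroup.coe_mul, ← toMul_add, ← map_add]
    refine congrArg (fun ψ => _ * (_ * (_ * ((ι ψ).toMul : G)))) ?_
    simp only [QuadData.cocycle]
    abel

theorem lift_apply (hd : d.IsRealizedBy ι x y z) (a : Quad d) :
    lift hd a = x ^ a.i.val * (y ^ a.j.val * (z ^ a.k.val * (ι a.φ).toMul)) := rfl

theorem lift_surjective (hd : d.IsRealizedBy ι x y z) (h : Generates x y z) :
    Function.Surjective (lift hd) :=
  MonoidHom.range_eq_top.1 <| h.eq_top
    ⟨⟨1, 0, 0, 0⟩, by simp [lift_apply, ZMod.val_one]⟩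
    ⟨⟨0, 1, 0, 0⟩, by simp [lift_apply, ZMod.val_one]⟩
    ⟨⟨0, 0, 1, 0⟩, by simp [lift_apply, ZMod.val_one]⟩

end Quad

/-- The squares of `G` are those of `⟨y, z⟩`. -/
theorem IsMinTriple.notMem_closure_squares (h : IsMinTriple g y z) (hg : g ∈ Subgroup.center G)
    (hg2 : g * g = 1) : g ∉ Subgroup.closure (Set.range fun u : G => u * u) := by
  have hyz : IsMinTriple y z g := h.swap₁₂.swap₂₃
  have hnormal : (Subgroup.closure {g}).Normal := by
    refine ⟨fun a ha u => ?_⟩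
    have hle : Subgroup.closure {g} ≤ Subgroup.center G := by simpa using hg
    rwa [Subgroup.mem_center_iff.1 (hle ha) u, mul_inv_cancel_right]
  refine fun hmem => hyz.notMem_closure_pair ((Subgroup.closure_le _).2 ?_ hmem)
  rintro _ ⟨u, rfl⟩
  have hu : u ∈ Subgroup.closure {y, z} ⊔ Subgroup.closure {g} :=
    hyz.closure_pair_sup_closure ▸ Subgroup.mem_top u
  obtain ⟨a, ha, b, hb, rfl⟩ := Subgroup.mem_sup_of_normal_right.1 hu
  obtain ⟨n, rfl⟩ := Subgroup.mem_closure_singleton.1 hb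
  have hcomm : Commute a (g ^ n) := Subgroup.mem_center_iff.1 (zpow_mem hg n) a
  have hsq : a * g ^ n * (a * g ^ n) = a * a := by
    rw [hcomm.symm.mul_mul_mul_comm, ← (Commute.refl g).mul_zpow, hg2, one_zpow, mul_one]
  exact show a * g ^ n * (a * g ^ n) ∈ _ from hsq ▸ mul_mem ha ha

theorem IsMinTriple.exists_isMinTriple_mul (h : IsMinTriple x y z) (i j k : ZMod 2) :
    (i = 0 ∧ j = 0 ∧ k = 0) ∨
      ∃ u v, IsMinTriple (x ^ i.val * (y ^ j.val * z ^ k.val)) u v := by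
  rcases zmod_two_eq_zero_or_one i with rfl | rfl
  · rcases zmod_two_eq_zero_or_one j with rfl | rfl
    · rcases zmod_two_eq_zero_or_one k with rfl | rfl
      · exact Or.inl ⟨rfl, rfl, rfl⟩
      · exact Or.inr ⟨x, y, by simpa [ZMod.val_one] using h.swap₂₃.swap₁₂⟩
    · have hy := h.swap₂₃.mul₃_right (pow_mem (mem_closure_pair_right x z) k.val)
      exact Or.inr ⟨x, z, by simpa [ZMod.val_one] using hy.swap₂₃.swap₁₂⟩
  · have hx := h.swap₁₂.swap₂₃.mul₃_right
      (mul_mem (pow_mem (mem_closure_pair_left y z) j.val)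
        (pow_mem (mem_closure_pair_right y z) k.val))
    exact Or.inr ⟨y, z, by simpa [ZMod.val_one] using hx.swap₂₃.swap₁₂⟩

theorem IsMinTriple.nonempty_mulEquiv (h : IsMinTriple x y z) (hd : d.IsRealizedBy ι x y z)
    (hinj : Function.Injective ι)
    (hsq : ∀ φ, ((ι φ).toMul : G) ∈ Subgroup.closure (Set.range fun u : G => u * u)) :
    Nonempty (Quad d ≃* G) := by
  refine ⟨MulEquiv.ofBijective (Quad.lift hd) ⟨?_, Quad.lift_surjective hd h.generates⟩⟩
  rw [injective_iff_map_eq_one]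
  rintro ⟨i, j, k, φ⟩ ha
  have hφ2 : ((ι φ).toMul : G) * (ι φ).toMul = 1 := by
    rw [← Subgroup.coe_mul, ← toMul_add, ← map_add, ← two_smul (ZMod 2) φ,
      show (2 : ZMod 2) = 0 from rfl, zero_smul, map_zero, toMul_zero, Subgroup.coe_one]
  have hw : x ^ i.val * (y ^ j.val * z ^ k.val) = (ι φ).toMul := by
    rw [← inv_eq_of_mul_eq_one_left hφ2, ← mul_eq_one_iff_eq_inv]
    simpa only [Quad.lift_apply, mul_assoc] using ha
  rcases h.exists_isMinTriple_mul i j k with ⟨rfl, rfl, rfl⟩ | ⟨u, v, huv⟩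
  · have hφ : (ι φ).toMul = 1 := Subtype.ext (by simpa using hw.symm)
    rw [(map_eq_zero_iff ι hinj).1 (toMul_eq_one.1 hφ), Quad.one_def]
  · rw [hw] at huv
    exact absurd (hsq φ) (huv.notMem_closure_squares (ι φ).toMul.2 hφ2)

end Realization

section Representations

/-- The direct product of a quaternion group and a group of order `2`. -/
def dataQ8C2 : QuadData (ZMod 2) := ⟨1, 1, 0, 1, 0, 0⟩

/-- The group of order `32` with `x ^ 2 = (x * y) ^ 2`, `(x * z) ^ 2 = (x * y * z) ^ 2` and
commuting involutions `y`, `z`. -/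
def dataRep32 : QuadData (ZMod 2 × ZMod 2) := ⟨(1, 0), 0, 0, 0, (1, 1), 0⟩

/-- The group of order `64` with independent squares `x ^ 2`, `(x * y) ^ 2`, `(x * z) ^ 2` and
commuting involutions `y`, `z`. -/
def dataRep64 : QuadData (ZMod 2 × ZMod 2 × ZMod 2) :=
  ⟨(1, 0, 0), 0, 0, (1, 1, 0), (1, 0, 1), 0⟩

theorem closure_range_eq_top_of_words {G ι : Type*} [Group G] {e : ι → G} (w : G → List ι)
    (hw : ∀ a, ((w a).map e).prod = a) : Subgroup.closure (Set.range e) = ⊤ := by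
  refine top_le_iff.1 fun a _ => ?_
  rw [← hw a]
  refine list_prod_mem fun g hg => ?_
  obtain ⟨i, -, rfl⟩ := List.mem_map.1 hg
  exact Subgroup.subset_closure ⟨i, rfl⟩

/-- The word `l` raised to the power `a`; words in elements of a family are lists of indices. -/
def wordPow {ι : Type*} {n : ℕ} (l : List ι) (a : ZMod n) : List ι :=
  (List.replicate a.val l).flatten

/-- The connection set of a representation of `Quad dataRep64`. -/
def connectionSet64 : Fin 6 → Quad dataRep64 :=
  ![⟨1, 0, 0, (0, 0, 0)⟩, ⟨1, 1, 0, (0, 0, 0)⟩, ⟨1, 0, 1, (0, 0, 0)⟩, ⟨1, 1, 1, (1, 1, 1)⟩,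
    ⟨1, 1, 0, (1, 0, 0)⟩, ⟨1, 0, 1, (1, 0, 1)⟩]

theorem admitsORR_dataRep64 : AdmitsORR (Quad dataRep64) :=
  admitsORR_of_pathWeight (e := connectionSet64) (by decide +kernel) (by decide +kernel)
    (closure_range_eq_top_of_words (fun a => wordPow [0] a.i ++ wordPow [0, 0, 0, 1] a.j ++
      wordPow [0, 0, 0, 2] a.k ++ wordPow [0, 0] a.φ.1 ++ wordPow [1, 1] a.φ.2.1 ++
      wordPow [2, 2] a.φ.2.2) (by decide +kernel))
    ![![0, 2, 1, 1, 1, 1], ![2, 0, 2, 0, 3, 1], ![1, 2, 0, 0, 1, 0], ![1, 0, 0, 0, 0, 1],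
      ![1, 3, 1, 0, 0, 1], ![1, 1, 0, 1, 1, 0]] (by decide +kernel) (by decide +kernel)

/-- The connection set of a representation of `Quad dataRep32`. -/
def connectionSet32 : Fin 6 → Quad dataRep32 :=
  ![⟨1, 0, 0, (0, 0)⟩, ⟨1, 1, 0, (0, 0)⟩, ⟨1, 0, 1, (0, 0)⟩, ⟨1, 1, 1, (0, 0)⟩,
    ⟨1, 0, 1, (1, 0)⟩, ⟨1, 0, 0, (1, 1)⟩]

theorem admitsORR_dataRep32 : AdmitsORR (Quad dataRep32) :=
  admitsORR_of_pathWeight (e := connectionSet32) (by decide +kernel) (by decide +kernel)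
    (closure_range_eq_top_of_words (fun a => wordPow [0] a.i ++ wordPow [0, 0, 0, 1] a.j ++
      wordPow [0, 0, 0, 2] a.k ++ wordPow [0, 0] a.φ.1 ++ wordPow [2, 2] a.φ.2)
      (by decide +kernel))
    ![![0, 0, 2, 1, 3, 2], ![0, 0, 1, 2, 3, 2], ![2, 1, 0, 0, 3, 2], ![1, 2, 0, 0, 2, 1],
      ![3, 3, 3, 2, 0, 3], ![2, 2, 2, 1, 3, 0]] (by decide +kernel) (by decide +kernel)

/-- The connection set of a representation of `Quad dataQ8C2`. -/
def connectionSetQ8C2 : Fin 4 → Quad dataQ8C2 :=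
  ![⟨1, 0, 0, 0⟩, ⟨0, 1, 0, 0⟩, ⟨1, 1, 0, 0⟩, ⟨1, 0, 1, 0⟩]

theorem admitsORR_dataQ8C2 : AdmitsORR (Quad dataQ8C2) :=
  admitsORR_of_pathWeight (e := connectionSetQ8C2) (by decide +kernel) (by decide +kernel)
    (closure_range_eq_top_of_words (fun a => wordPow [0] a.i ++ wordPow [1] a.j ++
      wordPow [0, 0, 0, 3] a.k ++ wordPow [0, 0] a.φ) (by decide +kernel))
    ![![0, 101, 1, 0], ![1, 0, 101, 1], ![101, 1, 0, 1], ![0, 1, 1, 0]]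
    (by decide +kernel) (by decide +kernel)

/-- The connection set of a representation of an elementary abelian group of order `27`. -/
def connectionSetC3 : Fin 6 → (C 3 × C 3) × C 3 :=
  ![((.ofAdd 1, 1), 1), ((1, .ofAdd 1), 1), ((.ofAdd 1, .ofAdd 1), 1), ((.ofAdd 1, .ofAdd 2), 1),
    ((1, 1), .ofAdd 1), ((.ofAdd 1, 1), .ofAdd 1)]

theorem admitsORR_C3_C3_C3 : AdmitsORR ((C 3 × C 3) × C 3) :=
  admitsORR_of_pathWeight (e := connectionSetC3) (by decide +kernel) (by decide +kernel)
    (closure_range_eq_top_of_words (fun a => wordPow [0] a.1.1.toAdd ++ wordPow [1] a.1.2.toAdd ++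
      wordPow [4] a.2.toAdd) (by decide +kernel))
    ![![0, 3, 100, 1, 2, 100], ![102, 0, 102, 102, 0, 2], ![1, 3, 0, 100, 2, 0],
      ![100, 3, 1, 0, 2, 2], ![2, 0, 0, 0, 0, 102], ![1, 0, 0, 0, 3, 0]]
    (by decide +kernel) (by decide +kernel)

end Representations

section AbelianModels

variable {G : Type*} [Group G] {x y z : G} {H : Subgroup G} {n p q : ℕ}

theorem exists_injective_range_eq_zpowers (hx : orderOf x = n) :
    ∃ f : C n →* G, Function.Injective f ∧ f.range = Subgroup.zpowers x := by
  subst hx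
  rw [← Nat.card_zpowers]
  let e : C (Nat.card (Subgroup.zpowers x)) ≃* Subgroup.zpowers x :=
    zmodCyclicMulEquiv inferInstance
  refine ⟨(Subgroup.zpowers x).subtype.comp e.toMonoidHom,
    Subtype.val_injective.comp e.injective, ?_⟩
  have he : e.toMonoidHom.range = ⊤ := MonoidHom.range_eq_top.2 e.surjective
  rw [MonoidHom.range_comp, he, ← MonoidHom.range_eq_map, Subgroup.range_subtype]

theorem disjoint_zpowers_of_notMem (hz : (orderOf z).Prime) (hzH : z ∉ H) :
    Disjoint H (Subgroup.zpowers z) := by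
  have : Fact (Nat.card (Subgroup.zpowers z)).Prime := ⟨Nat.card_zpowers z ▸ hz⟩
  rcases (H.subgroupOf (Subgroup.zpowers z)).eq_bot_or_eq_top_of_prime_card with hbot | htop
  · exact Subgroup.subgroupOf_eq_bot.1 hbot
  · exact absurd (Subgroup.subgroupOf_eq_top.1 htop (Subgroup.mem_zpowers z)) hzH

theorem exists_injective_range_eq_sup {A : Type*} [Group A] {f : A →* G}
    (hf : Function.Injective f) (hy : orderOf y = p) (hp : p.Prime) (hyf : y ∉ f.range)
    (hcomm : f.range ≤ Subgroup.centralizer {y}) :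
    ∃ g : A × C p →* G, Function.Injective g ∧ g.range = f.range ⊔ Subgroup.zpowers y := by
  obtain ⟨fy, hfy, hrange⟩ := exists_injective_range_eq_zpowers hy
  have hcomm' : ∀ a b, Commute (f a) (fy b) := fun a b => by
    obtain ⟨k, hk⟩ := Subgroup.mem_zpowers_iff.1 (hrange ▸ ⟨b, rfl⟩ : fy b ∈ Subgroup.zpowers y)
    have ha : Commute (f a) y := Subgroup.mem_centralizer_singleton_iff.1 (hcomm ⟨a, rfl⟩)
    exact hk ▸ ha.zpow_right k
  refine ⟨f.noncommCoprod fy hcomm', (MonoidHom.noncommCoprod_injective _ _ _).2 ⟨hf, hfy, ?_⟩, ?_⟩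
  · exact hrange ▸ disjoint_zpowers_of_notMem (hy ▸ hp) hyf
  · rw [MonoidHom.noncommCoprod_range, hrange]

theorem IsMinTriple.nonempty_mulEquiv_of_commute (h : IsMinTriple x y z) (hxy : Commute x y)
    (hxz : Commute x z) (hyz : Commute y z) (hx : orderOf x = n) (hy : orderOf y = p)
    (hz : orderOf z = q) (hp : p.Prime) (hq : q.Prime) :
    Nonempty ((C n × C p) × C q ≃* G) := by
  obtain ⟨f, hf, hfx⟩ := exists_injective_range_eq_zpowers hx
  obtain ⟨g, hg, hgxy⟩ := exists_injective_range_eq_sup hf hy hp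
    (hfx.symm ▸ h.notMem_zpowers (Subgroup.mem_zpowers x))
    (hfx.symm ▸ Subgroup.zpowers_le.2 (Subgroup.mem_centralizer_singleton_iff.2 hxy))
  rw [hfx, Subgroup.zpowers_eq_closure, Subgroup.zpowers_eq_closure, ← Subgroup.closure_union,
    Set.singleton_union] at hgxy
  obtain ⟨e, he, hexyz⟩ := exists_injective_range_eq_sup hg hz hq
    (hgxy.symm ▸ h.notMem_closure_pair)
    (hgxy.symm ▸ closure_pair_le (Subgroup.mem_centralizer_singleton_iff.2 hxz)
      (Subgroup.mem_centralizer_singleton_iff.2 hyz))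
  refine ⟨MulEquiv.ofBijective e ⟨he, MonoidHom.range_eq_top.1 ?_⟩⟩
  rw [hexyz, hgxy, Subgroup.zpowers_eq_closure, h.closure_pair_sup_closure]

theorem nonempty_mulEquiv_C6_C2_C2 : Nonempty ((C 6 × C 2) × C 2 ≃* C 3 × (Fin 3 → C 2)) :=
  ⟨MulEquiv.ofBijective (MonoidHom.mk' (fun a =>
    (.ofAdd a.1.1.toAdd.cast, ![.ofAdd a.1.1.toAdd.cast, a.1.2, a.2])) (by decide +kernel))
    (by decide +kernel)⟩

end AbelianModels

section NoRepresentation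

variable {M : Type*} [Group M]

theorem not_admitsORR_of_forall_mulAut
    (h : ∀ S : Set M, (∀ a ∈ S, ∀ b ∈ S, a * b ≠ 1) →
      ∃ α : MulAut M, α ≠ 1 ∧ ∀ a, α a ∈ S ↔ a ∈ S) :
    ¬ AdmitsORR M := by
  rw [admitsORR_iff]
  rintro ⟨S, hS, hfix⟩
  obtain ⟨α, hα1, hα⟩ := h S hS
  have hαS : α.toEquiv ∈ digraphAut (cayley S) := mem_digraphAut_cayley.2 fun x y => by
    simpa using hα (y * x⁻¹)
  exact hα1 (MulEquiv.ext fun a =>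
    mem_fixedSubgroup.1 (hfix ▸ Subgroup.mem_top a) α.toEquiv hαS (map_one α))

/-- The set `S` is encoded by the odd function to `ZMod 3` with value `1` on `S`; `v` is its
restriction to representatives `r` of the pairs `{a, a⁻¹}` with `a ≠ a⁻¹`. -/
theorem not_admitsORR_of_transversal [Finite M] {ι κ : Type*} (r : ι → M)
    (hr : ∀ a, a * a = 1 ∨ ∃ i, a = r i ∨ a = (r i)⁻¹) (α : κ → M →* M)
    (hinj : ∀ k a, α k a = 1 → a = 1) (hne : ∀ k, ∃ a, α k a ≠ a)
    (hv : ∀ v : ι → ZMod 3, ∃ k, ∀ i, ∃ j,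
      v i = v j ∧ α k (r i) = r j ∨ v i = -v j ∧ α k (r i) = (r j)⁻¹) :
    ¬ AdmitsORR M := by
  classical
  refine not_admitsORR_of_forall_mulAut fun S hS => ?_
  let c : M → ZMod 3 := fun a => if a ∈ S then 1 else if a⁻¹ ∈ S then -1 else 0
  have hone : (1 : ZMod 3) ≠ -1 := by decide
  have hinvS : ∀ a ∈ S, a⁻¹ ∉ S := fun a ha ha' => hS a ha _ ha' (mul_inv_cancel a)
  have hc_mem : ∀ a, a ∈ S ↔ c a = 1 := fun a => by
    by_cases ha : a ∈ S <;> by_cases ha' : a⁻¹ ∈ S <;> simp [c, ha, ha', hone.symm]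
  have hc_inv : ∀ a, c a⁻¹ = -c a := fun a => by
    by_cases ha : a ∈ S
    · simp [c, ha, hinvS a ha]
    · by_cases ha' : a⁻¹ ∈ S <;> simp [c, ha, ha']
  have hc_one : ∀ a, a * a = 1 → c a = 0 := fun a ha => by
    have h : c a = -c a := by rw [← hc_inv, inv_eq_of_mul_eq_one_left ha]
    exact (by decide : ∀ t : ZMod 3, t = -t → t = 0) _ h
  obtain ⟨k, hk⟩ := hv fun i => c (r i)
  have hcr : ∀ i, c (α k (r i)) = c (r i) := fun i => by
    obtain ⟨j, ⟨hij, hj⟩ | ⟨hij, hj⟩⟩ := hk i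
    · rw [hj, hij]
    · rw [hj, hij, hc_inv]
  have hbij : Function.Bijective (α k) :=
    Finite.injective_iff_bijective.1 ((injective_iff_map_eq_one _).2 (hinj k))
  obtain ⟨b, hb⟩ := hne k
  refine ⟨MulEquiv.ofBijective (α k) hbij, fun h => hb (DFunLike.congr_fun h b), fun a => ?_⟩
  change α k a ∈ S ↔ a ∈ S
  rw [hc_mem, hc_mem]
  obtain ha | ⟨i, rfl | rfl⟩ := hr a
  · rw [hc_one a ha, hc_one _ (by rw [← map_mul, ha, map_one])]
  · rw [hcr]
  · rw [map_inv, hc_inv, hc_inv, hcr]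

end NoRepresentation

section Quad

variable {Φ : Type*} [AddCommGroup Φ] [Module (ZMod 2) Φ] {d : QuadData Φ}

/-- The inclusion of `Φ` as a central subgroup of `Quad d`. -/
def Quad.centralHom (d : QuadData Φ) : Φ →+ Additive (Subgroup.center (Quad d)) :=
  AddMonoidHom.mk' (fun φ => .ofMul ⟨⟨0, 0, 0, φ⟩, Subgroup.mem_center_iff.2 fun g => by
    simp [Quad.mul_def, QuadData.cocycle, add_comm]⟩) fun a b =>
    congrArg Additive.ofMul (Subtype.ext (by simp [Quad.mul_def, QuadData.cocycle]))

instance {G : Type*} [Group G] [DecidableEq G] {ι : Φ →+ Additive (Subgroup.center G)}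
    {x y z : G} : Decidable (d.IsRealizedBy ι x y z) :=
  decidable_of_iff (x * x = (ι d.sx).toMul ∧ y * y = (ι d.sy).toMul ∧ z * z = (ι d.sz).toMul ∧
      y * x = x * (y * (ι d.cyx).toMul) ∧ z * x = x * (z * (ι d.czx).toMul) ∧
      z * y = y * (z * (ι d.czy).toMul))
    ⟨fun ⟨hx, hy, hz, hyx, hzx, hzy⟩ => ⟨hx, hy, hz, hyx, hzx, hzy⟩,
      fun ⟨hx, hy, hz, hyx, hzx, hzy⟩ => ⟨hx, hy, hz, hyx, hzx, hzy⟩⟩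

/-- The direct product of a cyclic group of order `4` and two groups of order `2`. -/
def dataC4 : QuadData (ZMod 2) := ⟨1, 0, 0, 0, 0, 0⟩

/-- The central product of a quaternion group and a cyclic group of order `4`. -/
def data16 : QuadData (ZMod 2) := ⟨1, 1, 1, 0, 1, 0⟩

/-- The group of order `32` with `x ^ 2 * y ^ 2 * z ^ 2 = 1` in which the products of distinct
generators are involutions. -/
def data32 : QuadData (ZMod 2 × ZMod 2) := ⟨(1, 0), (0, 1), (1, 1), (1, 1), (0, 1), (1, 0)⟩

/-- The images of the generators under some automorphisms of `Quad dataC4`. -/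
def autC4 : Fin 6 → Quad dataC4 × Quad dataC4 × Quad dataC4 :=
  ![(⟨1, 0, 0, 0⟩, ⟨0, 1, 0, 0⟩, ⟨0, 1, 1, 0⟩), (⟨1, 0, 0, 0⟩, ⟨0, 1, 0, 0⟩, ⟨0, 1, 1, 1⟩),
    (⟨1, 0, 0, 0⟩, ⟨0, 0, 1, 0⟩, ⟨0, 1, 0, 0⟩), (⟨1, 0, 0, 0⟩, ⟨0, 1, 1, 0⟩, ⟨0, 0, 1, 0⟩),
    (⟨1, 0, 0, 0⟩, ⟨0, 0, 1, 1⟩, ⟨0, 1, 0, 1⟩), (⟨1, 0, 0, 0⟩, ⟨0, 1, 1, 1⟩, ⟨0, 0, 1, 0⟩)]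

theorem isRealizedBy_autC4 : ∀ k, dataC4.IsRealizedBy (Quad.centralHom dataC4)
    (autC4 k).1 (autC4 k).2.1 (autC4 k).2.2 := by
  decide +kernel

theorem not_admitsORR_dataC4 : ¬ AdmitsORR (Quad dataC4) :=
  not_admitsORR_of_transversal ![⟨1, 0, 0, 0⟩, ⟨1, 1, 0, 0⟩, ⟨1, 0, 1, 0⟩, ⟨1, 1, 1, 0⟩]
    (by decide +kernel) (fun k => Quad.lift (isRealizedBy_autC4 k)) (by decide +kernel)
    (by decide +kernel) (by decide +kernel)

/-- The images of the generators under some automorphisms of `Quad data16`. -/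
def aut16 : Fin 14 → Quad data16 × Quad data16 × Quad data16 :=
  ![(⟨1, 0, 0, 0⟩, ⟨0, 1, 0, 1⟩, ⟨0, 0, 1, 0⟩), (⟨1, 0, 0, 0⟩, ⟨0, 1, 0, 0⟩, ⟨1, 0, 1, 0⟩),
    (⟨0, 0, 1, 0⟩, ⟨0, 1, 0, 0⟩, ⟨1, 0, 0, 0⟩), (⟨0, 0, 1, 0⟩, ⟨0, 1, 0, 0⟩, ⟨1, 0, 1, 0⟩),
    (⟨0, 0, 1, 0⟩, ⟨0, 1, 0, 0⟩, ⟨1, 0, 0, 1⟩), (⟨0, 0, 1, 0⟩, ⟨0, 1, 0, 0⟩, ⟨1, 0, 1, 1⟩),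
    (⟨1, 0, 1, 0⟩, ⟨0, 1, 0, 0⟩, ⟨0, 0, 1, 0⟩), (⟨1, 0, 1, 0⟩, ⟨0, 1, 0, 0⟩, ⟨1, 0, 0, 1⟩),
    (⟨1, 0, 1, 0⟩, ⟨0, 1, 0, 0⟩, ⟨0, 0, 1, 1⟩), (⟨1, 0, 0, 1⟩, ⟨0, 1, 0, 0⟩, ⟨1, 0, 1, 0⟩),
    (⟨1, 0, 0, 1⟩, ⟨0, 1, 0, 0⟩, ⟨1, 0, 1, 1⟩), (⟨0, 0, 1, 1⟩, ⟨0, 1, 0, 0⟩, ⟨1, 0, 1, 0⟩),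
    (⟨0, 0, 1, 1⟩, ⟨0, 1, 0, 0⟩, ⟨1, 0, 0, 1⟩), (⟨1, 0, 1, 1⟩, ⟨0, 1, 0, 0⟩, ⟨0, 0, 1, 1⟩)]

theorem isRealizedBy_aut16 : ∀ k, data16.IsRealizedBy (Quad.centralHom data16)
    (aut16 k).1 (aut16 k).2.1 (aut16 k).2.2 := by
  decide +kernel

theorem not_admitsORR_data16 : ¬ AdmitsORR (Quad data16) :=
  not_admitsORR_of_transversal ![⟨1, 0, 0, 0⟩, ⟨0, 1, 0, 0⟩, ⟨0, 0, 1, 0⟩, ⟨1, 0, 1, 0⟩]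
    (by decide +kernel) (fun k => Quad.lift (isRealizedBy_aut16 k)) (by decide +kernel)
    (by decide +kernel) (by decide +kernel)

/-- The automorphism of the center of `Quad data32` that fixes `x ^ 2` and interchanges `y ^ 2`
and `z ^ 2`. -/
def centerShear : ZMod 2 × ZMod 2 →+ ZMod 2 × ZMod 2 where
  toFun a := (a.1 + a.2, a.2)
  map_zero' := rfl
  map_add' := by decide

/-- The images of the generators under some automorphisms of `Quad data32`: the first six act
trivially on the center, the others act by `centerShear`. -/
def aut32 : Fin 14 → Quad data32 × Quad data32 × Quad data32 :=
  ![(⟨1, 0, 0, (0, 0)⟩, ⟨0, 1, 0, (0, 0)⟩, ⟨0, 0, 1, (1, 0)⟩),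
    (⟨1, 0, 0, (0, 0)⟩, ⟨0, 1, 0, (0, 0)⟩, ⟨0, 0, 1, (0, 1)⟩),
    (⟨1, 0, 0, (0, 0)⟩, ⟨0, 1, 0, (1, 0)⟩, ⟨0, 0, 1, (0, 0)⟩),
    (⟨1, 0, 0, (0, 0)⟩, ⟨0, 1, 0, (1, 1)⟩, ⟨0, 0, 1, (0, 0)⟩),
    (⟨1, 0, 0, (0, 1)⟩, ⟨0, 1, 0, (0, 0)⟩, ⟨0, 0, 1, (0, 0)⟩),
    (⟨1, 0, 0, (1, 1)⟩, ⟨0, 1, 0, (0, 0)⟩, ⟨0, 0, 1, (0, 0)⟩),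
    (⟨1, 0, 0, (0, 0)⟩, ⟨0, 0, 1, (0, 0)⟩, ⟨0, 1, 0, (0, 0)⟩),
    (⟨1, 0, 0, (0, 0)⟩, ⟨0, 0, 1, (1, 0)⟩, ⟨0, 1, 0, (1, 0)⟩),
    (⟨1, 0, 0, (0, 0)⟩, ⟨0, 0, 1, (0, 1)⟩, ⟨0, 1, 0, (1, 1)⟩),
    (⟨1, 0, 0, (0, 0)⟩, ⟨0, 0, 1, (1, 1)⟩, ⟨0, 1, 0, (0, 1)⟩),
    (⟨1, 0, 0, (1, 0)⟩, ⟨0, 0, 1, (0, 0)⟩, ⟨0, 1, 0, (0, 0)⟩),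
    (⟨1, 0, 0, (1, 0)⟩, ⟨0, 0, 1, (1, 0)⟩, ⟨0, 1, 0, (1, 0)⟩),
    (⟨1, 0, 0, (1, 0)⟩, ⟨0, 0, 1, (0, 1)⟩, ⟨0, 1, 0, (1, 1)⟩),
    (⟨1, 0, 0, (1, 0)⟩, ⟨0, 0, 1, (1, 1)⟩, ⟨0, 1, 0, (0, 1)⟩)]

theorem isRealizedBy_aut32 : ∀ k, data32.IsRealizedBy
    ((Quad.centralHom data32).comp (if k < 6 then .id _ else centerShear))
    (aut32 k).1 (aut32 k).2.1 (aut32 k).2.2 := by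
  decide +kernel

theorem not_admitsORR_data32 : ¬ AdmitsORR (Quad data32) :=
  not_admitsORR_of_transversal
    ![⟨1, 0, 0, (0, 0)⟩, ⟨0, 1, 0, (0, 0)⟩, ⟨0, 0, 1, (0, 0)⟩, ⟨0, 1, 0, (1, 0)⟩,
      ⟨0, 0, 1, (1, 0)⟩, ⟨1, 0, 0, (0, 1)⟩]
    (by decide +kernel) (fun k => Quad.lift (isRealizedBy_aut32 k)) (by decide +kernel)
    (by decide +kernel)
    (by simp only [Fin.forall_fin_succ_pi, Fin.forall_fin_zero_pi]; decide +kernel)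

end Quad

section Transvections

/-- The points of the Fano plane, as the nonzero binary vectors of length `3`. -/
def fanoPoint (i : Fin 7) (b : Fin 3) : ZMod 2 := if (i.val + 1).testBit b then 1 else 0

/-- For each transvection of a vector space of order `8`, the two pairs of points that it
transposes. -/
def transvectionPairs : Fin 21 → (Fin 7 × Fin 7) × (Fin 7 × Fin 7) :=
  ![((0, 2), (4, 6)), ((1, 2), (5, 6)), ((0, 1), (4, 5)), ((0, 3), (2, 5)), ((1, 3), (2, 4)),
    ((0, 4), (2, 6)), ((3, 4), (5, 6)), ((1, 4), (2, 3)), ((0, 6), (1, 3)), ((1, 5), (2, 6)),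
    ((0, 5), (1, 4)), ((0, 6), (2, 4)), ((1, 6), (2, 5)), ((0, 4), (1, 5)), ((3, 5), (4, 6)),
    ((3, 6), (4, 5)), ((0, 2), (3, 5)), ((0, 5), (2, 3)), ((1, 2), (3, 4)), ((0, 1), (3, 6)),
    ((0, 3), (1, 6))]

open Matrix in
/-- The transvection that transposes the pairs `transvectionPairs k`: if these are
`{p, p + w}` and `{q, q + w}`, it fixes the plane spanned by `w` and `p + q` pointwise. -/
def fanoTransvection (k : Fin 21) : (Fin 3 → ZMod 2) →ₗ[ZMod 2] (Fin 3 → ZMod 2) :=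
  let p := fanoPoint (transvectionPairs k).1.1
  let w := p + fanoPoint (transvectionPairs k).1.2
  let q := fanoPoint (transvectionPairs k).2.1
  LinearMap.transvection (dotProductEquiv (ZMod 2) (Fin 3) (w ⨯₃ (p + q))) w

theorem fanoTransvection_fanoPoint : ∀ k i, ∃ j,
    fanoTransvection k (fanoPoint i) = fanoPoint j ∧
      (i = j ∨ s(i, j) = s((transvectionPairs k).1.1, (transvectionPairs k).1.2) ∨
        s(i, j) = s((transvectionPairs k).2.1, (transvectionPairs k).2.2)) := by
  decide +kernel

theorem exists_transvectionPairs : ∀ v : Fin 7 → ZMod 3, ∃ k,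
    v (transvectionPairs k).1.1 = v (transvectionPairs k).1.2 ∧
      v (transvectionPairs k).2.1 = v (transvectionPairs k).2.2 := by
  simp only [Fin.forall_fin_succ_pi, Fin.forall_fin_zero_pi]
  decide +kernel

theorem exists_fanoTransvection_preserving (v : Fin 7 → ZMod 3) :
    ∃ k, ∀ i, ∃ j, fanoTransvection k (fanoPoint i) = fanoPoint j ∧ v i = v j := by
  obtain ⟨k, hp, hq⟩ := exists_transvectionPairs v
  refine ⟨k, fun i => ?_⟩
  obtain ⟨j, hj, hij⟩ := fanoTransvection_fanoPoint k i
  refine ⟨j, hj, ?_⟩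
  simp only [Sym2.eq_iff] at hij
  rcases hij with rfl | (⟨rfl, rfl⟩ | ⟨rfl, rfl⟩) | ⟨rfl, rfl⟩ | ⟨rfl, rfl⟩
  exacts [rfl, hp, hp.symm, hq, hq.symm]

theorem not_admitsORR_C3_C2_C2_C2 : ¬ AdmitsORR (C 3 × (Fin 3 → C 2)) := by
  have hmodel : ¬ AdmitsORR (C 3 × Multiplicative (Fin 3 → ZMod 2)) :=
    not_admitsORR_of_transversal (ι := Option (Fin 7))
      (fun i => (.ofAdd 1, .ofAdd (i.elim 0 fanoPoint))) (by decide +kernel)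
      (fun k => (MonoidHom.id _).prodMap
        (AddMonoidHom.toMultiplicative (fanoTransvection k).toAddMonoidHom))
      (by decide +kernel) (by decide +kernel) fun v => by
        obtain ⟨k, hk⟩ := exists_fanoTransvection_preserving fun i => v (some i)
        refine ⟨k, fun i => ?_⟩
        rcases i with _ | i
        · exact ⟨none, Or.inl ⟨rfl, Prod.ext rfl (map_zero (fanoTransvection k))⟩⟩
        · obtain ⟨j, hj, hij⟩ := hk i
          exact ⟨some j, Or.inl ⟨hij, Prod.ext rfl hj⟩⟩
  exact fun h => hmodel (h.of_mulEquiv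
    ((MulEquiv.refl (C 3)).prodCongr (MulEquiv.piMultiplicative fun _ => ZMod 2).symm))

end Transvections

section InvolutionHom

variable {A Φ : Type*} [CommGroup A] {q r s : A}

/-- The homomorphism from the cyclic group of order `2` that maps its generator to `q`. -/
def involutionHom (q : A) (hq : q * q = 1) : ZMod 2 →+ Additive A :=
  ZMod.lift 2 ⟨zmultiplesHom (Additive A) (.ofMul q), by
    simp [two_zsmul, ← ofMul_mul, hq]⟩

theorem involutionHom_apply (hq : q * q = 1) (i : ZMod 2) :
    involutionHom q hq i = .ofMul (q ^ i.val) := by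
  rcases zmod_two_eq_zero_or_one i with rfl | rfl
  · simp
  · simpa [involutionHom, ZMod.val_one] using
      ZMod.lift_coe 2 (A := Additive A) ⟨zmultiplesHom (Additive A) (.ofMul q), _⟩ 1

theorem injective_involutionHom (hq : q * q = 1) (hq1 : q ≠ 1) :
    Function.Injective (involutionHom q hq) := by
  refine (injective_iff_map_eq_zero _).2 fun i hi => ?_
  rcases zmod_two_eq_zero_or_one i with rfl | rfl
  · rfl
  · simp [involutionHom_apply, ZMod.val_one, hq1] at hi

theorem injective_involutionHom_coprod [AddCommGroup Φ] {f : Φ →+ Additive A}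
    (hf : Function.Injective f) (hq : q * q = 1) (hqf : ∀ φ, (f φ).toMul ≠ q) :
    Function.Injective ((involutionHom q hq).coprod f) := by
  refine (injective_iff_map_eq_zero _).2 fun ⟨i, φ⟩ h => ?_
  rw [AddMonoidHom.coprod_apply, involutionHom_apply] at h
  rcases zmod_two_eq_zero_or_one i with rfl | rfl
  · simpa [map_eq_zero_iff f hf] using h
  · rw [ZMod.val_one, pow_one, ← neg_eq_iff_add_eq_zero, ← ofMul_inv,
      inv_eq_of_mul_eq_one_left hq] at h
    exact absurd (congrArg Additive.toMul h.symm) (hqf φ)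

theorem injective_involutionHom₂ (hq : q * q = 1) (hr : r * r = 1) (hq1 : q ≠ 1) (hr1 : r ≠ 1)
    (hqr : q ≠ r) : Function.Injective ((involutionHom q hq).coprod (involutionHom r hr)) := by
  refine injective_involutionHom_coprod (injective_involutionHom hr hr1) hq fun i => ?_
  rcases zmod_two_eq_zero_or_one i with rfl | rfl <;>
    simp [involutionHom_apply, ZMod.val_one, hq1.symm, hqr.symm]

theorem injective_involutionHom₃ (hq : q * q = 1) (hr : r * r = 1) (hs : s * s = 1) (hq1 : q ≠ 1)
    (hr1 : r ≠ 1) (hs1 : s ≠ 1) (hqr : q ≠ r) (hqs : q ≠ s) (hrs : r ≠ s) (hqrs : q ≠ r * s) :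
    Function.Injective
      ((involutionHom q hq).coprod ((involutionHom r hr).coprod (involutionHom s hs))) := by
  refine injective_involutionHom_coprod (injective_involutionHom₂ hr hs hr1 hs1 hrs) hq fun i => ?_
  obtain ⟨i, j⟩ := i
  rcases zmod_two_eq_zero_or_one i with rfl | rfl <;>
    rcases zmod_two_eq_zero_or_one j with rfl | rfl <;>
    simp [involutionHom_apply, ZMod.val_one, hq1.symm, hqr.symm, hqs.symm, hqrs.symm]

end InvolutionHom

open scoped IsMulCommutative

section CentralSquares

variable {G : Type*} [Group G] {x y z : G} {a b c d e f q r s : Subgroup.center G}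

theorem mul_self_comm (h : x * y * (x * y) = d) : y * x * (y * x) = d := by
  calc y * x * (y * x) = y * (x * y * (x * y)) * y⁻¹ := by group
    _ = d := by rw [h, ← (center_commute d y).eq, mul_inv_cancel_right]

theorem mul_eq_of_mul_self (hx : x * x = a) (hy : y * y = b) (hxy : x * y * (x * y) = d)
    (ha : a * a = 1) (hb : b * b = 1) :
    y * x = x * (y * (a * (b * d) : Subgroup.center G)) := by
  have hxi : x⁻¹ = x * a := inv_eq_of_mul_eq_one_right (by rw [← mul_assoc, hx]; exact_mod_cast ha)
  have hyi : y⁻¹ = y * b := inv_eq_of_mul_eq_one_right (by rw [← mul_assoc, hy]; exact_mod_cast hb)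
  calc y * x = x⁻¹ * (x * y * (x * y)) * y⁻¹ := by group
    _ = x * a * (d * (y * b)) := by rw [hxy, hxi, hyi, mul_assoc]
    _ = x * (y * (b * (a * d) : Subgroup.center G)) := by
      rw [(center_commute d _).eq, mul_assoc x, (center_commute a _).eq, Subgroup.coe_mul,
        Subgroup.coe_mul, (center_commute a d).eq]
      simp only [mul_assoc]
    _ = x * (y * (a * (b * d) : Subgroup.center G)) := by rw [mul_left_comm b]

/-- The elements `x`, `y`, `z`, `x * y`, `x * z`, `y * z` have the squares `a`, …, `f`, and these
are central of order at most `2`. -/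
structure CentralSquares (x y z : G) (a b c d e f : Subgroup.center G) : Prop where
  mul_self_x : x * x = a
  mul_self_y : y * y = b
  mul_self_z : z * z = c
  mul_self_xy : x * y * (x * y) = d
  mul_self_xz : x * z * (x * z) = e
  mul_self_yz : y * z * (y * z) = f
  mul_self_a : a * a = 1
  mul_self_b : b * b = 1
  mul_self_c : c * c = 1
  mul_self_d : d * d = 1
  mul_self_e : e * e = 1
  mul_self_f : f * f = 1

namespace CentralSquares

theorem swap₁₂ (h : CentralSquares x y z a b c d e f) : CentralSquares y x z b a c d f e :=
  ⟨h.mul_self_y, h.mul_self_x, h.mul_self_z, mul_self_comm h.mul_self_xy, h.mul_self_yz,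
    h.mul_self_xz, h.mul_self_b, h.mul_self_a, h.mul_self_c, h.mul_self_d, h.mul_self_f,
    h.mul_self_e⟩

theorem swap₂₃ (h : CentralSquares x y z a b c d e f) : CentralSquares x z y a c b e d f :=
  ⟨h.mul_self_x, h.mul_self_z, h.mul_self_y, h.mul_self_xz, h.mul_self_xy,
    mul_self_comm h.mul_self_yz, h.mul_self_a, h.mul_self_c, h.mul_self_b, h.mul_self_e,
    h.mul_self_d, h.mul_self_f⟩

theorem comm_yx (h : CentralSquares x y z a b c d e f) :
    y * x = x * (y * (a * (b * d) : Subgroup.center G)) :=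
  mul_eq_of_mul_self h.mul_self_x h.mul_self_y h.mul_self_xy h.mul_self_a h.mul_self_b

theorem comm_zx (h : CentralSquares x y z a b c d e f) :
    z * x = x * (z * (a * (c * e) : Subgroup.center G)) := h.swap₂₃.comm_yx

theorem comm_zy (h : CentralSquares x y z a b c d e f) :
    z * y = y * (z * (b * (c * f) : Subgroup.center G)) := h.swap₁₂.swap₂₃.comm_yx

theorem mul_self_xyz (h : CentralSquares x y z a b c d e f) :
    x * y * z * (x * y * z) = (a * b * c * d * e * f : Subgroup.center G) := by
  have hp := center_commute (a * (b * d))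
  have hr := center_commute (a * (c * e))
  have hs := center_commute (b * (c * f))
  calc x * y * z * (x * y * z) = x * y * (z * x) * (y * z) := by group
    _ = x * y * x * z * ((a * (c * e) : Subgroup.center G) * (y * z)) := by rw [h.comm_zx]; group
    _ = x * (y * x) * (z * y) * z * (a * (c * e) : Subgroup.center G) := by rw [(hr _).eq]; group
    _ = x * x * y * ((a * (b * d) : Subgroup.center G) * (y * z)) *
        ((b * (c * f) : Subgroup.center G) * z) * (a * (c * e) : Subgroup.center G) := by
      rw [h.comm_yx, h.comm_zy]; group
    _ = x * x * (y * y) * (z * z) * ((a * (b * d) : Subgroup.center G) *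
        (b * (c * f) : Subgroup.center G) * (a * (c * e) : Subgroup.center G)) := by
      rw [(hp _).eq, (hs z).eq]
      simp only [mul_assoc, (hp _).left_comm]
    _ = ((a * a) * (b * b) * (c * c) * (a * b * c * d * e * f) : Subgroup.center G) := by
      rw [h.mul_self_x, h.mul_self_y, h.mul_self_z]
      norm_cast
      ac_rfl
    _ = (a * b * c * d * e * f : Subgroup.center G) := by
      simp only [h.mul_self_a, h.mul_self_b, h.mul_self_c, one_mul]

theorem mul_self_prod (h : CentralSquares x y z a b c d e f) :
    (a * b * c * d * e * f) * (a * b * c * d * e * f) = 1 := by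
  calc (a * b * c * d * e * f) * (a * b * c * d * e * f)
      = (a * a) * (b * b) * (c * c) * (d * d) * (e * e) * (f * f) := by ac_rfl
    _ = 1 := by simp only [h.mul_self_a, h.mul_self_b, h.mul_self_c, h.mul_self_d, h.mul_self_e,
        h.mul_self_f, mul_one]

theorem mul₂ (h : CentralSquares x y z a b c d e f) :
    CentralSquares x (x * y) z a d c b e (a * b * c * d * e * f) := by
  refine ⟨h.mul_self_x, h.mul_self_xy, h.mul_self_z, ?_, h.mul_self_xz, h.mul_self_xyz,
    h.mul_self_a, h.mul_self_d, h.mul_self_c, h.mul_self_b, h.mul_self_e, h.mul_self_prod⟩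
  have ha : (a : G) * a = 1 := by exact_mod_cast h.mul_self_a
  rw [← mul_assoc x x y, h.mul_self_x, (center_commute a y).symm.mul_mul_mul_comm, ha, one_mul,
    h.mul_self_y]

theorem isRealizedBy {Φ : Type*} [AddCommGroup Φ] {D : QuadData Φ}
    {ι : Φ →+ Additive (Subgroup.center G)} (h : CentralSquares x y z a b c d e f)
    (hx : a = (ι D.sx).toMul) (hy : b = (ι D.sy).toMul) (hz : c = (ι D.sz).toMul)
    (hyx : a * (b * d) = (ι D.cyx).toMul) (hzx : a * (c * e) = (ι D.czx).toMul)
    (hzy : b * (c * f) = (ι D.czy).toMul) : D.IsRealizedBy ι x y z where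
  mul_self_x := hx ▸ h.mul_self_x
  mul_self_y := hy ▸ h.mul_self_y
  mul_self_z := hz ▸ h.mul_self_z
  comm_yx := hyx ▸ h.comm_yx
  comm_zx := hzx ▸ h.comm_zx
  comm_zy := hzy ▸ h.comm_zy

theorem isRealizedBy_data16 (h : CentralSquares x y z q q q 1 q 1) :
    data16.IsRealizedBy (involutionHom q h.mul_self_a) x y z := by
  apply h.isRealizedBy <;>
    simp [data16, involutionHom_apply, ZMod.val_one, h.mul_self_a]

theorem isRealizedBy_data32 (h : CentralSquares x y z q r (q * r) 1 1 1) :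
    data32.IsRealizedBy ((involutionHom q h.mul_self_a).coprod (involutionHom r h.mul_self_b))
      x y z := by
  apply h.isRealizedBy <;>
    simp [data32, involutionHom_apply, ZMod.val_one, ← mul_assoc q q, h.mul_self_a,
      mul_left_comm r q, h.mul_self_b]

end CentralSquares

end CentralSquares

section Relators

variable {F G : Type*} [Group F] [Group G] {x y z g : G}

theorem image_relators16 (f : F →* G) (x y z : F) :
    f '' relators16 x y z = relators16 (f x) (f y) (f z) := by
  simp [relators16, Set.image_insert_eq]

theorem image_relators32 (f : F →* G) (x y z : F) :
    f '' relators32 x y z = relators32 (f x) (f y) (f z) := by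
  simp [relators32, Set.image_insert_eq]

theorem Generates.mem_center (h : Generates x y z) (hx : Commute g x) (hy : Commute g y)
    (hz : Commute g z) : g ∈ Subgroup.center G := by
  have htop : Subgroup.centralizer {g} = ⊤ :=
    h.eq_top (Subgroup.mem_centralizer_singleton_iff.2 hx.symm)
      (Subgroup.mem_centralizer_singleton_iff.2 hy.symm)
      (Subgroup.mem_centralizer_singleton_iff.2 hz.symm)
  exact Subgroup.mem_center_iff.2 fun u =>
    Subgroup.mem_centralizer_singleton_iff.1 (htop ▸ Subgroup.mem_top u)

theorem mul_self_mul_self (hx : x ^ 4 = 1) : x * x * (x * x) = 1 := by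
  rw [← pow_two x, ← pow_add, hx]

theorem Generates.exists_centralSquares_of_relators16 (h : Generates x y z)
    (hrel : ∀ r ∈ relators16 x y z, r = 1) :
    ∃ q : Subgroup.center G, CentralSquares x y z q q q 1 q 1 := by
  simp only [relators16, Set.mem_insert_iff, Set.mem_singleton_iff, forall_eq_or_imp, forall_eq,
    mul_inv_eq_one, inv_inv, pow_two] at hrel
  obtain ⟨x4, -, -, yx, -, yz, -, xz, zxz, xy⟩ := hrel
  have hxz : x * z * (x * z) = x * x := by
    calc x * z * (x * z) = z * (z⁻¹ * x * z * x) * z := by group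
      _ = x * x := by rw [zxz, mul_one, xz]
  have hc := h.mem_center ((Commute.refl x).mul_left (Commute.refl x))
    (xy ▸ (Commute.refl y).mul_left (Commute.refl y))
    (xz ▸ (Commute.refl z).mul_left (Commute.refl z))
  have hq : (⟨x * x, hc⟩ : Subgroup.center G) * ⟨x * x, hc⟩ = 1 :=
    Subtype.ext (mul_self_mul_self x4)
  exact ⟨⟨x * x, hc⟩, rfl, xy.symm, xz.symm, mul_self_comm yx, hxz, yz, hq, hq, hq, one_mul 1, hq,
    one_mul 1⟩

theorem Generates.exists_centralSquares_of_relators32 (h : Generates x y z)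
    (hrel : ∀ r ∈ relators32 x y z, r = 1) :
    ∃ q r : Subgroup.center G, CentralSquares x y z q r (q * r) 1 1 1 := by
  simp only [relators32, Set.mem_insert_iff, Set.mem_singleton_iff, forall_eq_or_imp,
    forall_eq] at hrel
  obtain ⟨x4, y4, z4, xy, xy', xz, xz', yz, yz', xyz⟩ := hrel
  have hyx : IsTwistedPair y x := ⟨xy, xy'⟩
  have hzx : IsTwistedPair z x := ⟨xz, xz'⟩
  have hzy : IsTwistedPair z y := ⟨yz, yz'⟩
  have hx : x * x ∈ Subgroup.center G :=
    pow_two x ▸ h.mem_center ((Commute.refl x).pow_left 2) (hyx.symm.commute_sq x4)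
      (hzx.symm.commute_sq x4)
  have hy : y * y ∈ Subgroup.center G :=
    pow_two y ▸ h.mem_center (hyx.commute_sq y4) ((Commute.refl y).pow_left 2)
      (hzy.symm.commute_sq y4)
  have hz : z * z = x * x * (y * y) := by
    rw [← inv_eq_of_mul_eq_one_left (mul_self_mul_self z4), ← pow_two, ← pow_two, ← pow_two,
      eq_inv_of_mul_eq_one_left xyz]
  rw [pow_two] at xy xz yz
  set q : Subgroup.center G := ⟨x * x, hx⟩
  set r : Subgroup.center G := ⟨y * y, hy⟩
  have hq : q * q = 1 := Subtype.ext (mul_self_mul_self x4)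
  have hr : r * r = 1 := Subtype.ext (mul_self_mul_self y4)
  have hqr : q * r * (q * r) = 1 := by rw [mul_mul_mul_comm, hq, hr, one_mul]
  exact ⟨q, r, rfl, rfl, hz, xy, xz, yz, hq, hr, hqr, one_mul 1, one_mul 1, one_mul 1⟩

end Relators

section Presentations

theorem generates_of {rels : Set (FreeGroup (Fin 3))} :
    Generates (PresentedGroup.of (rels := rels) 0) (PresentedGroup.of 1) (PresentedGroup.of 2) := by
  have hrange : Set.range (PresentedGroup.of (rels := rels)) =
      {PresentedGroup.of 0, PresentedGroup.of 1, PresentedGroup.of 2} := by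
    ext g
    simp [Fin.exists_fin_succ, eq_comm]
  rw [Generates, ← hrange, PresentedGroup.closure_range_of]

theorem forall_mem_relators16_eq_one : ∀ r ∈ relators16 (PresentedGroup.of 0 : Group16)
    (PresentedGroup.of 1) (PresentedGroup.of 2), r = 1 :=
  image_relators16 (PresentedGroup.mk _) _ _ _ ▸
    Set.forall_mem_image.2 fun _ hr => PresentedGroup.one_of_mem hr

theorem forall_mem_relators32_eq_one : ∀ r ∈ relators32 (PresentedGroup.of 0 : Group32)
    (PresentedGroup.of 1) (PresentedGroup.of 2), r = 1 :=
  image_relators32 (PresentedGroup.mk _) _ _ _ ▸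
    Set.forall_mem_image.2 fun _ hr => PresentedGroup.one_of_mem hr

variable {Φ : Type*}

/-- The generators `x`, `y`, `z` of `Quad d`. -/
def Quad.gens [Zero Φ] (d : QuadData Φ) : Fin 3 → Quad d :=
  ![⟨1, 0, 0, 0⟩, ⟨0, 1, 0, 0⟩, ⟨0, 0, 1, 0⟩]

variable [AddCommGroup Φ] [Module (ZMod 2) Φ] {d : QuadData Φ}

theorem nonempty_mulEquiv_presentedGroup {rels : Set (FreeGroup (Fin 3))}
    {ι : Φ →+ Additive (Subgroup.center (PresentedGroup rels))}
    (hd : d.IsRealizedBy ι (PresentedGroup.of 0) (PresentedGroup.of 1) (PresentedGroup.of 2))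
    (hgens : Subgroup.closure (Set.range (Quad.gens d)) = ⊤)
    (hrel : ∀ r ∈ rels, FreeGroup.lift (Quad.gens d) r = 1) :
    Nonempty (PresentedGroup rels ≃* Quad d) := by
  have hleft : (Quad.lift hd).comp (PresentedGroup.toGroup hrel) = MonoidHom.id _ := by
    ext i
    fin_cases i <;> simp [Quad.gens, Quad.lift_apply, ZMod.val_one]
  have hsurj : (PresentedGroup.toGroup hrel).range = ⊤ := by
    rw [← top_le_iff, ← hgens, Subgroup.closure_le]
    rintro _ ⟨i, rfl⟩
    exact ⟨PresentedGroup.of i, by simp⟩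
  have hinj : Function.Injective (PresentedGroup.toGroup hrel) :=
    Function.LeftInverse.injective (g := Quad.lift hd) (DFunLike.congr_fun hleft)
  exact ⟨MulEquiv.ofBijective _ ⟨hinj, MonoidHom.range_eq_top.1 hsurj⟩⟩

theorem nonempty_group16_mulEquiv : Nonempty (Group16 ≃* Quad data16) := by
  obtain ⟨q, hq⟩ := generates_of.exists_centralSquares_of_relators16 forall_mem_relators16_eq_one
  refine nonempty_mulEquiv_presentedGroup hq.isRealizedBy_data16
    (closure_range_eq_top_of_words (fun a => wordPow [0] a.i ++ wordPow [1] a.j ++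
      wordPow [2] a.k ++ wordPow [0, 0] a.φ) (by decide +kernel)) ?_
  rw [← Set.forall_mem_image (p := (· = 1)), image_relators16]
  simp only [FreeGroup.lift_apply_of, relators16, Set.mem_insert_iff, Set.mem_singleton_iff,
    forall_eq_or_imp, forall_eq]
  decide +kernel

theorem nonempty_group32_mulEquiv : Nonempty (Group32 ≃* Quad data32) := by
  obtain ⟨q, r, hqr⟩ :=
    generates_of.exists_centralSquares_of_relators32 forall_mem_relators32_eq_one
  refine nonempty_mulEquiv_presentedGroup hqr.isRealizedBy_data32
    (closure_range_eq_top_of_words (fun a => wordPow [0] a.i ++ wordPow [1] a.j ++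
      wordPow [2] a.k ++ wordPow [0, 0] a.φ.1 ++ wordPow [1, 1] a.φ.2) (by decide +kernel)) ?_
  rw [← Set.forall_mem_image (p := (· = 1)), image_relators32]
  simp only [FreeGroup.lift_apply_of, relators32, Set.mem_insert_iff, Set.mem_singleton_iff,
    forall_eq_or_imp, forall_eq]
  decide +kernel

theorem card_group16 : Nat.card Group16 = 16 := by
  obtain ⟨f⟩ := nonempty_group16_mulEquiv
  rw [Nat.card_congr f.toEquiv, Nat.card_congr (Quad.equivProd _)]
  simp

theorem card_group32 : Nat.card Group32 = 32 := by
  obtain ⟨f⟩ := nonempty_group32_mulEquiv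
  rw [Nat.card_congr f.toEquiv, Nat.card_congr (Quad.equivProd _)]
  simp

theorem nonempty_dataC4_mulEquiv : Nonempty (Quad dataC4 ≃* C 4 × (Fin 2 → C 2)) := by
  let f : Quad dataC4 →* C 4 × (Fin 2 → C 2) :=
    MonoidHom.mk' (fun a => (.ofAdd (a.i.val + 2 * a.φ.val : ℕ), ![.ofAdd a.j, .ofAdd a.k]))
      (by decide +kernel)
  have hf : Function.Bijective f :=
    (Fintype.bijective_iff_injective_and_card f).2 ⟨by decide +kernel, by decide +kernel⟩
  exact ⟨MulEquiv.ofBijective f hf⟩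

theorem IsExceptional.not_admitsORR {G : Type*} [Group G] (hG : IsExceptional G) :
    ¬ AdmitsORR G := by
  intro h
  rcases hG with ⟨⟨f⟩⟩ | ⟨⟨f⟩⟩ | ⟨⟨f⟩⟩ | ⟨⟨f⟩⟩
  · exact not_admitsORR_dataC4 (h.of_mulEquiv (f.trans nonempty_dataC4_mulEquiv.some.symm))
  · exact not_admitsORR_C3_C2_C2_C2 (h.of_mulEquiv f)
  · exact not_admitsORR_data32 (h.of_mulEquiv (f.trans nonempty_group32_mulEquiv.some))
  · exact not_admitsORR_data16 (h.of_mulEquiv (f.trans nonempty_group16_mulEquiv.some))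

end Presentations

section OrderNotFour

variable {G : Type*} [Group G] {x y z : G}

theorem pow_four_eq_one_of_sq_eq_one (hx : x ^ 2 = 1) : x ^ 4 = 1 := by
  rw [show 4 = 2 * 2 from rfl, pow_mul, hx, one_pow]

theorem pow_four_eq_one_of_inverts (hxy : x * y = y * x⁻¹) (hsq : x ^ 2 = y ^ 2) : x ^ 4 = 1 := by
  have hconj : SemiconjBy y x⁻¹ x := hxy.symm
  have hinv : SemiconjBy y (x ^ 2)⁻¹ (x ^ 2) := by simpa using hconj.pow_right 2
  have hcomm : SemiconjBy y (x ^ 2) (x ^ 2) := hsq ▸ (Commute.refl y).pow_right 2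
  have : x ^ 2 = (x ^ 2)⁻¹ := mul_left_cancel (hcomm.eq.trans hinv.eq.symm)
  rw [show 4 = 2 * 2 from rfl, pow_mul, pow_two (x ^ 2)]
  exact mul_eq_one_iff_eq_inv.2 this

theorem orderOf_eq_six (hx : x ^ 6 = 1) (hx2 : x ^ 2 ≠ 1) (hx3 : x ^ 3 ≠ 1) : orderOf x = 6 := by
  refine orderOf_eq_of_pow_and_pow_div_prime (by norm_num) hx fun p hp hdvd => ?_
  rcases hp.dvd_mul.1 (show p ∣ 2 * 3 from hdvd) with h | h
  · rwa [(Nat.prime_dvd_prime_iff_eq hp Nat.prime_two).1 h]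
  · rwa [(Nat.prime_dvd_prime_iff_eq hp Nat.prime_three).1 h]

namespace IsMinTriple

theorem commute_or_inverts (hD : ¬ IsGeneralizedDihedral G) (hO : ¬ AdmitsORR G)
    (h : IsMinTriple x y z) (hx : x ^ 4 ≠ 1) : Commute x y ∨ (y ^ 2 = 1 ∧ x * y = y * x⁻¹) := by
  rcases pair_cases hD hO h (mt pow_four_eq_one_of_sq_eq_one hx) with hc | hc | ⟨hc, hs⟩ | ⟨hc, -⟩
  · exact Or.inl hc
  · exact Or.inr hc
  · exact absurd (pow_four_eq_one_of_inverts hc hs) hx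
  · exact absurd hc hx

theorem not_commute_of_inverts (hD : ¬ IsGeneralizedDihedral G) (hO : ¬ AdmitsORR G)
    (h : IsMinTriple x y z) (hx : x ^ 4 ≠ 1) (hy : y ^ 2 = 1) (hxy : x * y = y * x⁻¹) :
    ¬ Commute x z := by
  intro hxz
  have hxi : x ≠ x⁻¹ := fun hi =>
    hx (pow_four_eq_one_of_sq_eq_one (by rwa [pow_two, mul_eq_one_iff_eq_inv]))
  have hinv : x * (z * y) = z * y * x⁻¹ := by
    rw [← mul_assoc, hxz.eq, mul_assoc, hxy, mul_assoc]
  have hzy : IsMinTriple x (z * y) y := (h.mul₃_right (mem_closure_pair_right x y)).swap₂₃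
  rcases commute_or_inverts hD hO hzy hx with hc | ⟨hzy2, -⟩
  · rw [hc.eq] at hinv
    exact hxi (mul_left_cancel hinv)
  · refine hD (h.swap₂₃.isGeneralizedDihedral hxz hy ?_ ?_)
    · rw [mul_assoc, hxy, inv_mul_cancel_left]
    · rw [pow_two, mul_assoc] at hzy2
      rw [inv_eq_self_of_sq_eq_one hy, inv_eq_of_mul_eq_one_right hzy2, mul_assoc]

theorem commute_of_pow_four_ne_one (hD : ¬ IsGeneralizedDihedral G) (hO : ¬ AdmitsORR G)
    (h : IsMinTriple x y z) (hx : x ^ 4 ≠ 1) : Commute x y := by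
  by_contra hc
  obtain ⟨hy, hxy⟩ := (commute_or_inverts hD hO h hx).resolve_left hc
  rcases commute_or_inverts hD hO h.swap₂₃ hx with hxz | ⟨-, hxz⟩
  · exact not_commute_of_inverts hD hO h hx hy hxy hxz
  · have hy' : SemiconjBy y x⁻¹ x := hxy.symm
    have hz' : SemiconjBy z x x⁻¹ := by simpa using SemiconjBy.inv_right hxz.symm
    exact not_commute_of_inverts hD hO (h.mul₃_left (mem_closure_pair_right x y)) hx hy hxy
      (hy'.mul_left hz').symm

theorem pow_cases_of_pow_four_ne_one (hD : ¬ IsGeneralizedDihedral G) (hO : ¬ AdmitsORR G)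
    (h : IsMinTriple x y z) (hx : x ^ 4 ≠ 1) :
    (x ^ 3 = 1 ∧ y ^ 3 = 1) ∨ (x ^ 6 = 1 ∧ x ^ 3 ≠ 1 ∧ ∃ j : ℕ, (y * x ^ j) ^ 2 = 1) := by
  rcases commute_cases hD hO h (commute_of_pow_four_ne_one hD hO h hx)
    (mt pow_four_eq_one_of_sq_eq_one hx) with hc | ⟨hc, -⟩ | hc
  · exact Or.inl hc
  · exact absurd hc hx
  · exact Or.inr hc

theorem pow_three_ne_one_of_pow_four_ne_one (hD : ¬ IsGeneralizedDihedral G)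
    (hO : ¬ AdmitsORR G) (h : IsMinTriple x y z) (hx : x ^ 4 ≠ 1) : x ^ 3 ≠ 1 := by
  intro hx3
  have hpow : ∀ {u v}, IsMinTriple x u v → u ^ 3 = 1 := fun h' => by
    rcases pow_cases_of_pow_four_ne_one hD hO h' hx with ⟨-, hu⟩ | ⟨-, hx', -⟩
    exacts [hu, absurd hx3 hx']
  have hy3 := hpow h
  have hy : y ^ 4 ≠ 1 := by
    rw [pow_succ, hy3, one_mul]
    exact h.swap₁₂.ne_one₁
  obtain ⟨f⟩ := nonempty_mulEquiv_of_commute h (commute_of_pow_four_ne_one hD hO h hx)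
    (commute_of_pow_four_ne_one hD hO h.swap₂₃ hx)
    (commute_of_pow_four_ne_one hD hO h.swap₁₂.swap₂₃ hy)
    (orderOf_eq_prime hx3 h.ne_one₁) (orderOf_eq_prime hy3 h.swap₁₂.ne_one₁)
    (orderOf_eq_prime (hpow h.swap₂₃) h.swap₂₃.swap₁₂.ne_one₁) Nat.prime_three Nat.prime_three
  exact hO (admitsORR_C3_C3_C3.of_mulEquiv f)

theorem nonempty_mulEquiv_of_pow_four_ne_one (hD : ¬ IsGeneralizedDihedral G)
    (hO : ¬ AdmitsORR G) (h : IsMinTriple x y z) (hx : x ^ 4 ≠ 1) :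
    Nonempty (G ≃* C 3 × (Fin 3 → C 2)) := by
  have hx3 := pow_three_ne_one_of_pow_four_ne_one hD hO h hx
  have hpow : ∀ {u v}, IsMinTriple x u v → x ^ 6 = 1 ∧ ∃ j : ℕ, (u * x ^ j) ^ 2 = 1 := fun h' => by
    rcases pow_cases_of_pow_four_ne_one hD hO h' hx with ⟨hx3', -⟩ | ⟨hx6, -, hj⟩
    exacts [absurd hx3' hx3, ⟨hx6, hj⟩]
  obtain ⟨hx6, j, hu⟩ := hpow h
  obtain ⟨-, k, hv⟩ := hpow h.swap₂₃
  have h' : IsMinTriple x (y * x ^ j) (z * x ^ k) := ((h.mul_pow₂ j).swap₂₃.mul_pow₂ k).swap₂₃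
  generalize y * x ^ j = u at hu h'
  generalize z * x ^ k = v at hv h'
  have hxu := commute_of_pow_four_ne_one hD hO h' hx
  have hxv := commute_of_pow_four_ne_one hD hO h'.swap₂₃ hx
  have huv : Commute u v := by
    have hxuv : IsMinTriple (x * u) v u :=
      (h'.swap₁₂.swap₂₃.mul₃_right (mem_closure_pair_left u v)).swap₂₃.swap₁₂.swap₂₃
    have hxu4 : (x * u) ^ 4 ≠ 1 := by
      rwa [hxu.mul_pow, pow_four_eq_one_of_sq_eq_one hu, mul_one]
    simpa using hxv.inv_left.mul_left (commute_of_pow_four_ne_one hD hO hxuv hxu4)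
  obtain ⟨f⟩ := nonempty_mulEquiv_of_commute h' hxu hxv huv
    (orderOf_eq_six hx6 (mt pow_four_eq_one_of_sq_eq_one hx) hx3)
    (orderOf_eq_prime hu h'.swap₁₂.ne_one₁) (orderOf_eq_prime hv h'.swap₂₃.swap₁₂.ne_one₁)
    Nat.prime_two Nat.prime_two
  exact nonempty_mulEquiv_C6_C2_C2.map f.symm.trans

end IsMinTriple

end OrderNotFour

section OrderFour

variable {G : Type*} [Group G] {x y z g : G} {a b c d e f q r s : Subgroup.center G}

/-- A triple realising `d(G) = 3` together with the squares of its elements and of their pairwise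
products. Modulo squares the group is the vector space `𝔽₂³`, and these are the labels of six of
the seven points of the Fano plane; by `CentralSquares.mul_self_xyz` the seventh label is the
product of all others. -/
structure MinCentralSquares (x y z : G) (a b c d e f : Subgroup.center G) : Prop
    extends IsMinTriple x y z, CentralSquares x y z a b c d e f

theorem coe_mem_closure_squares (hg : g * g = s) :
    (s : G) ∈ Subgroup.closure (Set.range fun u : G => u * u) :=
  Subgroup.subset_closure ⟨g, hg⟩

theorem coe_involutionHom_mem {H : Subgroup G} (hq : q * q = 1) (hqH : (q : G) ∈ H) (i : ZMod 2) :
    ((involutionHom q hq i).toMul : G) ∈ H := by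
  rw [involutionHom_apply]
  exact pow_mem hqH _

theorem sq_ne_one_of_mul_self (hg : g * g = s) (hs : s ≠ 1) : g ^ 2 ≠ 1 := by
  rw [pow_two, hg]
  exact_mod_cast hs

namespace MinCentralSquares

theorem swap₁₂ (h : MinCentralSquares x y z a b c d e f) : MinCentralSquares y x z b a c d f e :=
  ⟨h.toIsMinTriple.swap₁₂, h.toCentralSquares.swap₁₂⟩

theorem swap₂₃ (h : MinCentralSquares x y z a b c d e f) : MinCentralSquares x z y a c b e d f :=
  ⟨h.toIsMinTriple.swap₂₃, h.toCentralSquares.swap₂₃⟩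

theorem mul₂ (h : MinCentralSquares x y z a b c d e f) :
    MinCentralSquares x (x * y) z a d c b e (a * b * c * d * e * f) :=
  ⟨(h.toIsMinTriple.swap₂₃.mul₃_left (mem_closure_pair_left x z)).swap₂₃,
    h.toCentralSquares.mul₂⟩

theorem mul₃ (h : MinCentralSquares x y z a b c d e f) :
    MinCentralSquares x y (x * z) a b e d c (a * b * c * d * e * f) := by
  have := h.swap₂₃.mul₂.swap₂₃
  rwa [show a * c * b * e * d * f = a * b * c * d * e * f by ac_rfl] at this

section Models

theorem admitsORR_of_quaternion (h : MinCentralSquares x y z q q 1 q q q) (hq : q ≠ 1) :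
    AdmitsORR G := by
  have hd : dataQ8C2.IsRealizedBy (involutionHom q h.mul_self_a) x y z := by
    apply h.isRealizedBy <;> simp [dataQ8C2, involutionHom_apply, ZMod.val_one, h.mul_self_a]
  obtain ⟨φ⟩ := h.nonempty_mulEquiv hd (injective_involutionHom _ hq)
    (coe_involutionHom_mem _ (coe_mem_closure_squares h.mul_self_x))
  exact admitsORR_dataQ8C2.of_mulEquiv φ

theorem nonempty_mulEquiv_group16 (h : MinCentralSquares x y z q q q q 1 1) (hq : q ≠ 1) :
    Nonempty (G ≃* Group16) := by
  obtain ⟨φ⟩ := h.swap₂₃.nonempty_mulEquiv h.swap₂₃.isRealizedBy_data16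
    (injective_involutionHom _ hq)
    (coe_involutionHom_mem _ (coe_mem_closure_squares h.mul_self_x))
  exact nonempty_group16_mulEquiv.map fun ψ => (ψ.trans φ).symm

theorem nonempty_mulEquiv_C4_C2_C2 (h : MinCentralSquares x y z q 1 1 q q 1) (hq : q ≠ 1) :
    Nonempty (G ≃* C 4 × (Fin 2 → C 2)) := by
  have hd : dataC4.IsRealizedBy (involutionHom q h.mul_self_a) x y z := by
    apply h.isRealizedBy <;> simp [dataC4, involutionHom_apply, ZMod.val_one, h.mul_self_a]
  obtain ⟨φ⟩ := h.nonempty_mulEquiv hd (injective_involutionHom _ hq)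
    (coe_involutionHom_mem _ (coe_mem_closure_squares h.mul_self_x))
  exact nonempty_dataC4_mulEquiv.map φ.symm.trans

theorem admitsORR_of_two_squares (h : MinCentralSquares x y z q 1 1 q r 1) (hq : q ≠ 1)
    (hr : r ≠ 1) (hqr : q ≠ r) : AdmitsORR G := by
  have hd : dataRep32.IsRealizedBy
      ((involutionHom q h.mul_self_a).coprod (involutionHom r h.mul_self_e)) x y z := by
    apply h.isRealizedBy <;> simp [dataRep32, involutionHom_apply, ZMod.val_one, h.mul_self_a]
  obtain ⟨φ⟩ := h.nonempty_mulEquiv hd (injective_involutionHom₂ _ _ hq hr hqr) fun i =>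
    mul_mem (coe_involutionHom_mem h.mul_self_a (coe_mem_closure_squares h.mul_self_x) _)
      (coe_involutionHom_mem h.mul_self_e (coe_mem_closure_squares h.mul_self_xz) _)
  exact admitsORR_dataRep32.of_mulEquiv φ

theorem nonempty_mulEquiv_group32 (h : MinCentralSquares x y z q r (q * r) 1 1 1) (hq : q ≠ 1)
    (hr : r ≠ 1) (hqr : q ≠ r) : Nonempty (G ≃* Group32) := by
  obtain ⟨φ⟩ := h.nonempty_mulEquiv h.isRealizedBy_data32
    (injective_involutionHom₂ _ _ hq hr hqr) fun i =>
      mul_mem (coe_involutionHom_mem h.mul_self_a (coe_mem_closure_squares h.mul_self_x) _)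
        (coe_involutionHom_mem h.mul_self_b (coe_mem_closure_squares h.mul_self_y) _)
  exact nonempty_group32_mulEquiv.map fun ψ => (ψ.trans φ).symm

theorem admitsORR_of_three_squares (h : MinCentralSquares x y z q 1 1 r s 1) (hq : q ≠ 1)
    (hr : r ≠ 1) (hs : s ≠ 1) (hqr : q ≠ r) (hqs : q ≠ s) (hrs : r ≠ s) (hqrs : q ≠ r * s) :
    AdmitsORR G := by
  have hd : dataRep64.IsRealizedBy ((involutionHom q h.mul_self_a).coprod
      ((involutionHom r h.mul_self_d).coprod (involutionHom s h.mul_self_e))) x y z := by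
    apply h.isRealizedBy <;> simp [dataRep64, involutionHom_apply, ZMod.val_one]
  obtain ⟨φ⟩ := h.nonempty_mulEquiv hd
    (injective_involutionHom₃ _ _ _ hq hr hs hqr hqs hrs hqrs) fun i =>
      mul_mem (coe_involutionHom_mem h.mul_self_a (coe_mem_closure_squares h.mul_self_x) _)
        (mul_mem (coe_involutionHom_mem h.mul_self_d (coe_mem_closure_squares h.mul_self_xy) _)
          (coe_involutionHom_mem h.mul_self_e (coe_mem_closure_squares h.mul_self_xz) _))
  exact admitsORR_dataRep64.of_mulEquiv φ

theorem isGeneralizedDihedral_of_involutions (h : MinCentralSquares x y z q 1 1 q 1 1) :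
    IsGeneralizedDihedral G := by
  have hyx := h.comm_yx
  have hzy := h.comm_zy
  have hy := h.mul_self_y
  have hz := h.mul_self_z
  have hxz := h.mul_self_xz
  simp only [one_mul, h.mul_self_a, OneMemClass.coe_one, mul_one] at hyx hzy hy hz hxz
  refine h.isGeneralizedDihedral hyx.symm (by rw [pow_two, hz]) ?_ ?_
  · rw [mul_assoc] at hxz
    rw [inv_eq_of_mul_eq_one_left hz, inv_eq_of_mul_eq_one_right hxz, mul_assoc]
  · rw [mul_assoc, ← hzy, inv_mul_cancel_left, inv_eq_of_mul_eq_one_left hy]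

end Models

section Involutions

theorem isExceptional_of_commute_involution (hD : ¬ IsGeneralizedDihedral G) (hO : ¬ AdmitsORR G)
    (h : MinCentralSquares x y z a 1 1 a e 1) (ha : a ≠ 1) : IsExceptional G := by
  by_cases hea : e = a
  · subst hea
    exact Or.inl (h.nonempty_mulEquiv_C4_C2_C2 ha)
  by_cases he : e = 1
  · subst he
    exact absurd h.isGeneralizedDihedral_of_involutions hD
  · exact absurd (h.admitsORR_of_two_squares ha he (Ne.symm hea)) hO

theorem nonempty_mulEquiv_group32_of_involutions (h : MinCentralSquares x y z a 1 1 1 e 1)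
    (ha : a ≠ 1) (he : e ≠ 1) (hea : e ≠ a) : Nonempty (G ≃* Group32) := by
  have hprod : e * a * (a * e) = 1 := by
    rw [mul_assoc, ← mul_assoc a, h.mul_self_a, one_mul, h.mul_self_e]
  have hmul : e * (a * e) = a := by rw [mul_left_comm, h.mul_self_e, mul_one]
  have hae : a * e ≠ 1 := fun hae => hea
    ((inv_eq_of_mul_eq_one_right hae).symm.trans (inv_eq_of_mul_eq_one_right h.mul_self_a))
  have h' : MinCentralSquares (x * z) (x * z * y) x e (a * e) (e * (a * e)) 1 1 1 := by
    simpa only [mul_one, hprod, hmul] using h.swap₂₃.mul₂.swap₁₂.swap₂₃.mul₂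
  exact h'.nonempty_mulEquiv_group32 he hae (by simpa using ha)

theorem isExceptional_of_involutions (hD : ¬ IsGeneralizedDihedral G) (hO : ¬ AdmitsORR G)
    (h : MinCentralSquares x y z a 1 1 d e 1) (ha : a ≠ 1) : IsExceptional G := by
  have isExceptional_group32 : ∀ {x y z : G} {e}, MinCentralSquares x y z a 1 1 1 e 1 → e ≠ 1 →
      e ≠ a → IsExceptional G := fun h he hea =>
    Or.inr (Or.inr (Or.inl (h.nonempty_mulEquiv_group32_of_involutions ha he hea)))
  by_cases hda : d = a
  · subst hda
    exact h.isExceptional_of_commute_involution hD hO ha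
  by_cases hea : e = a
  · subst hea
    exact h.swap₂₃.isExceptional_of_commute_involution hD hO ha
  have hyz := h.swap₁₂.mul₃.swap₁₂
  simp only [mul_one, one_mul] at hyz
  by_cases hde : d = e
  · subst hde
    rw [mul_assoc, h.mul_self_d, mul_one] at hyz
    exact hyz.swap₂₃.isExceptional_of_commute_involution hD hO ha
  by_cases hd : d = 1
  · subst hd
    exact isExceptional_group32 h (Ne.symm hde) hea
  by_cases he : e = 1
  · subst he
    exact isExceptional_group32 h.swap₂₃ hde hda
  by_cases hade : a = d * e
  · rw [mul_assoc, ← hade, h.mul_self_a] at hyz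
    exact isExceptional_group32 hyz.swap₂₃ hd hda
  · exact absurd (h.admitsORR_of_three_squares ha hd he (Ne.symm hda) (Ne.symm hea) hde hade) hO

end Involutions

end MinCentralSquares

section Existence

theorem IsMinTriple.commute_mul_self (hD : ¬ IsGeneralizedDihedral G) (hO : ¬ AdmitsORR G)
    (h : IsMinTriple x y z) (hx : x ^ 4 = 1) : Commute (x * x) y := by
  have hcomm : x * y = y * x⁻¹ → Commute (x * x) y := fun hc => by
    have hconj : SemiconjBy y x⁻¹ x := hc.symm
    have hsq := hconj.mul_right hconj
    rw [← mul_inv_rev, inv_eq_of_mul_eq_one_left (mul_self_mul_self hx)] at hsq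
    exact Commute.symm hsq
  by_cases hx2 : x ^ 2 = 1
  · rw [← pow_two, hx2]
    exact Commute.one_left y
  rcases pair_cases hD hO h hx2 with hc | ⟨-, hc⟩ | ⟨hc, -⟩ | ⟨-, -, hc⟩
  · exact hc.mul_left hc
  · exact hcomm hc
  · exact hcomm hc
  · rwa [← pow_two]

theorem IsMinTriple.exists_mul_self_eq (hD : ¬ IsGeneralizedDihedral G) (hO : ¬ AdmitsORR G)
    (h : IsMinTriple x y z) (hx : x ^ 4 = 1) :
    ∃ s : Subgroup.center G, x * x = s ∧ s * s = 1 :=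
  ⟨⟨x * x, h.generates.mem_center ((Commute.refl x).mul_left (Commute.refl x))
    (commute_mul_self hD hO h hx) (commute_mul_self hD hO h.swap₂₃ hx)⟩, rfl,
    Subtype.ext (mul_self_mul_self hx)⟩

theorem IsMinTriple.exists_minCentralSquares (hD : ¬ IsGeneralizedDihedral G)
    (hO : ¬ AdmitsORR G) (h4 : ∀ x y z : G, IsMinTriple x y z → x ^ 4 = 1)
    (h : IsMinTriple x y z) : ∃ a b c d e f, MinCentralSquares x y z a b c d e f := by
  have hsq : ∀ {x y z : G}, IsMinTriple x y z → ∃ s : Subgroup.center G, x * x = s ∧ s * s = 1 :=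
    fun h => exists_mul_self_eq hD hO h (h4 _ _ _ h)
  obtain ⟨a, ha, ha2⟩ := hsq h
  obtain ⟨b, hb, hb2⟩ := hsq h.swap₁₂
  obtain ⟨c, hc, hc2⟩ := hsq h.swap₂₃.swap₁₂
  obtain ⟨d, hd, hd2⟩ := hsq (h.swap₂₃.mul₃_left (mem_closure_pair_left _ _)).swap₂₃.swap₁₂
  obtain ⟨e, he, he2⟩ := hsq (h.mul₃_left (mem_closure_pair_left _ _)).swap₂₃.swap₁₂
  obtain ⟨f, hf, hf2⟩ := hsq (h.mul₃_left (mem_closure_pair_right _ _)).swap₂₃.swap₁₂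
  exact ⟨a, b, c, d, e, f, h, ha, hb, hc, hd, he, hf, ha2, hb2, hc2, hd2, he2, hf2⟩

end Existence

namespace MinCentralSquares

theorem sq_mul_inv_ne_one (h : MinCentralSquares x y z a b c d e f) (hd : d ≠ 1) :
    (y * x⁻¹) ^ 2 ≠ 1 := by
  have ha : (a : G) * a = 1 := by exact_mod_cast h.mul_self_a
  have hxi : x⁻¹ = x * a := inv_eq_of_mul_eq_one_right (by rw [← mul_assoc, h.mul_self_x, ha])
  refine sq_ne_one_of_mul_self ?_ hd
  rw [hxi, ← mul_assoc y, (center_commute a _).mul_mul_mul_comm, ha, mul_one,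
    mul_self_comm h.mul_self_xy]

theorem eq_one_or_eq (hD : ¬ IsGeneralizedDihedral G) (hO : ¬ AdmitsORR G)
    (h : MinCentralSquares x y z a b c d e f) : a = 1 ∨ b = 1 ∨ d = 1 ∨ (a = b ∧ b = d) := by
  by_contra! hne
  obtain ⟨ha, hb, hd, hq⟩ := hne
  obtain ⟨w, hw, hw2⟩ := h.exists_sq_ne_one hD
  have hx2 := sq_ne_one_of_mul_self h.mul_self_x ha
  have hy2 := sq_ne_one_of_mul_self h.mul_self_y hb
  by_cases hc : Commute x y
  · have hx4 : x ^ 4 = 1 := by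
      rw [show 4 = 2 * 2 from rfl, pow_mul, pow_two x, h.mul_self_x, pow_two]
      exact_mod_cast h.mul_self_a
    refine hO (hw.admitsORR_of_commute hw2 hc hx2 (fun hx3 => h.ne_one₁ ?_) hy2
      (sq_ne_one_of_mul_self h.mul_self_xy hd) ?_)
    · rwa [pow_succ, hx3, one_mul] at hx4
    · rwa [(hc.pow_left 2).mul_pow, ← pow_mul, hx4, one_mul]
  · refine hO (hw.admitsORR_of_not_commute hx2 hy2 (h.sq_mul_inv_ne_one hd) hw2 hc ?_)
    rintro ⟨hxy, hxx⟩
    rw [pow_two, pow_two, h.mul_self_x, h.mul_self_y] at hxx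
    refine hq (Subtype.ext hxx) (Subtype.ext ?_)
    rw [← h.mul_self_xy, ← h.mul_self_y]
    nth_rewrite 1 [hxy]
    group

theorem eq_one_or_eq_of_quaternion (hD : ¬ IsGeneralizedDihedral G) (hO : ¬ AdmitsORR G)
    (h : MinCentralSquares x y z q q c q e f) (hq : q ≠ 1) : c = 1 ∨ c = q := by
  by_contra! hc
  have eq_one : ∀ {u v : G} {b e f s}, MinCentralSquares u z v q c b s e f → s = 1 := fun h' => by
    rcases h'.eq_one_or_eq hD hO with hq1 | hc1 | hs | ⟨hqc, -⟩
    exacts [absurd hq1 hq, absurd hc1 hc.1, hs, absurd hqc.symm hc.2]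
  have hprod := eq_one h.mul₂.swap₁₂.swap₂₃
  rw [eq_one h.swap₂₃, eq_one h.swap₁₂.swap₂₃, h.mul_self_a, one_mul, mul_one, mul_one] at hprod
  exact hc.2 ((eq_inv_of_mul_eq_one_left hprod).trans (inv_eq_of_mul_eq_one_left h.mul_self_a))

theorem isExceptional_of_quaternion (hD : ¬ IsGeneralizedDihedral G) (hO : ¬ AdmitsORR G)
    (h : MinCentralSquares x y z q q c q e f) (hq : q ≠ 1) : IsExceptional G := by
  have isExceptional_of_labels : ∀ {x y z : G} {c e f}, MinCentralSquares x y z q q c q e f →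
      (c = 1 ∧ e = q ∧ f = q) ∨ (c = q ∧ e = 1 ∧ f = 1) → IsExceptional G := by
    rintro x y z c e f h (⟨rfl, rfl, rfl⟩ | ⟨rfl, rfl, rfl⟩)
    · exact absurd (h.admitsORR_of_quaternion hq) hO
    · exact Or.inr (Or.inr (Or.inr (h.nonempty_mulEquiv_group16 hq)))
  have hqq := h.mul_self_a
  have hxz := h.mul₃
  have hyz := h.swap₁₂.mul₃
  have hxyz := hxz.swap₁₂.mul₃
  -- The four labels outside the line multiply to `q`, so exactly one differs from the other three.
  rcases h.eq_one_or_eq_of_quaternion hD hO hq with rfl | rfl <;>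
    rcases hxz.eq_one_or_eq_of_quaternion hD hO hq with rfl | rfl <;>
    rcases hyz.eq_one_or_eq_of_quaternion hD hO hq with rfl | rfl
  · exact isExceptional_of_labels hxyz (by simp [hqq])
  · exact isExceptional_of_labels hyz (by simp [hqq])
  · exact isExceptional_of_labels hxz (by simp [hqq])
  · exact isExceptional_of_labels h (by simp)
  · exact isExceptional_of_labels h (by simp)
  · exact isExceptional_of_labels hxz (by simp [hqq])
  · exact isExceptional_of_labels hyz (by simp [hqq])
  · exact isExceptional_of_labels hxyz (by simp [hqq])

theorem mul_eq_one_of_involutions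
    (hline : ∀ {x y z : G} {a b c d e f}, MinCentralSquares x y z a b c d e f → a ≠ 1 →
      b = 1 ∨ d = 1)
    (h : MinCentralSquares x y z a 1 1 d e f) (ha : a ≠ 1) (hf : f ≠ 1) : a * d * e * f = 1 := by
  have hyz := h.swap₁₂.mul₃.swap₁₂
  simp only [mul_one, one_mul] at hyz
  rcases hline hyz.swap₂₃ ha with hf1 | hprod
  · exact absurd hf1 hf
  · rw [← hprod]
    ac_rfl

theorem eq_one_or_eq_one_of_involutions
    (hline : ∀ {x y z : G} {a b c d e f}, MinCentralSquares x y z a b c d e f → a ≠ 1 →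
      b = 1 ∨ d = 1)
    (h : MinCentralSquares x y z a 1 1 d e f) (hf : f ≠ 1) (hprod : a * d * e * f = 1) :
    d = 1 ∨ e = 1 := by
  by_contra! hne
  have hmix := h.swap₁₂.mul₂.mul₃.swap₁₂.swap₂₃
  have hprod' : a * d * f * e = 1 := by rw [← hprod]; ac_rfl
  simp only [mul_one, one_mul, hprod'] at hmix
  rcases hline hmix hne.1 with hf1 | hda
  · exact hf hf1
  · rw [mul_comm a d, hda, one_mul] at hprod'
    exact hne.2 hprod'

theorem isExceptional_of_forall_eq_one_or_eq_one (hD : ¬ IsGeneralizedDihedral G)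
    (hO : ¬ AdmitsORR G)
    (hline : ∀ {x y z : G} {a b c d e f}, MinCentralSquares x y z a b c d e f → a ≠ 1 →
      b = 1 ∨ d = 1)
    (h : MinCentralSquares x y z a b c d e f) (ha : a ≠ 1) : IsExceptional G := by
  obtain ⟨y, c, d, e, f, h⟩ : ∃ y c d e f, MinCentralSquares x y z a 1 c d e f := by
    rcases hline h ha with rfl | rfl
    exacts [⟨_, _, _, _, _, h⟩, ⟨_, _, _, _, _, h.mul₂⟩]
  obtain ⟨z, d, e, f, h⟩ : ∃ z d e f, MinCentralSquares x y z a 1 1 d e f := by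
    rcases hline h.swap₂₃ ha with rfl | rfl
    exacts [⟨_, _, _, _, h⟩, ⟨_, _, _, _, h.mul₃⟩]
  by_cases hf : f = 1
  · subst hf
    exact h.isExceptional_of_involutions hD hO ha
  have hprod := h.mul_eq_one_of_involutions hline ha hf
  have isExceptional : ∀ {y z : G} {e}, MinCentralSquares x y z a 1 1 1 e f → a * e * f = 1 →
      IsExceptional G := fun h hprod => by
    have hxy := h.mul₂
    simp only [mul_one, hprod] at hxy
    exact hxy.isExceptional_of_involutions hD hO ha
  rcases h.eq_one_or_eq_one_of_involutions hline hf hprod with rfl | rfl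
  · exact isExceptional h (by simpa using hprod)
  · exact isExceptional h.swap₂₃ (by simpa using hprod)

theorem isExceptional (hD : ¬ IsGeneralizedDihedral G) (hO : ¬ AdmitsORR G)
    (h : MinCentralSquares x y z a b c d e f) (ha : a ≠ 1) : IsExceptional G := by
  by_cases hQ : ∃ (x y z : G) (q c e f : Subgroup.center G),
      MinCentralSquares x y z q q c q e f ∧ q ≠ 1
  · obtain ⟨_, _, _, _, _, _, _, h', hq⟩ := hQ
    exact h'.isExceptional_of_quaternion hD hO hq
  · refine h.isExceptional_of_forall_eq_one_or_eq_one hD hO (fun h ha => ?_) ha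
    rcases h.eq_one_or_eq hD hO with ha1 | hb | hd | ⟨rfl, rfl⟩
    exacts [absurd ha1 ha, Or.inl hb, Or.inr hd, absurd ⟨_, _, _, _, _, _, _, h, ha⟩ hQ]

end MinCentralSquares

end OrderFour

section Classification

variable {G : Type*} [Group G]

theorem IsMinTriple.isExceptional {x y z : G} (hD : ¬ IsGeneralizedDihedral G)
    (hO : ¬ AdmitsORR G) (h : IsMinTriple x y z) : IsExceptional G := by
  by_cases h4 : ∀ x y z : G, IsMinTriple x y z → x ^ 4 = 1
  · obtain ⟨w, hw, hw2⟩ := h.exists_sq_ne_one hD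
    obtain ⟨a, _, _, _, _, _, h'⟩ := exists_minCentralSquares hD hO h4 hw.swap₂₃.swap₁₂
    refine h'.isExceptional hD hO fun ha => hw2 ?_
    rw [pow_two, h'.mul_self_x, ha, OneMemClass.coe_one]
  · push Not at h4
    obtain ⟨x, y, z, h, hx⟩ := h4
    exact Or.inr (Or.inl (nonempty_mulEquiv_of_pow_four_ne_one hD hO h hx))

theorem IsMinTriple.natCard_ne_two {x y z : G} (h : IsMinTriple x y z) : Nat.card G ≠ 2 := by
  intro hcard
  have : Fact (Nat.Prime 2) := ⟨Nat.prime_two⟩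
  exact h.notMem_zpowers (mem_zpowers_of_prime_card hcard h.ne_one₁)
    (mem_zpowers_of_prime_card hcard h.ne_one₁)

theorem exists_isMinTriple [Group.FG G] (hG : Group.rank G = 3) :
    ∃ x y z : G, IsMinTriple x y z := by
  classical
  obtain ⟨S, hS, hgen⟩ := Group.rank_spec G
  rw [hG, Finset.card_eq_three] at hS
  obtain ⟨x, y, z, -, -, -, rfl⟩ := hS
  refine ⟨x, y, z, by simpa [Generates] using hgen, fun a b hab => ?_⟩
  have hrank : Group.rank G ≤ ({a, b} : Finset G).card := Group.rank_le (by simpa using hab)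
  exact absurd (hG ▸ hrank.trans Finset.card_le_two) (by decide)

end Classification

end ORR

theorem theorem3p12_general :
    (∀ (G : Type*) [Group G] [Group.FG G], Group.rank G = 3 →
      (ORR.IsGeneralizedDihedral G ∨ ORR.AdmitsORR G ∨ ORR.IsExceptional G) ∧
      (ORR.IsGeneralizedDihedral G → ¬ ORR.AdmitsORR G)) ∧
    (∀ (G : Type*) [Group G], ORR.IsExceptional G → ¬ ORR.AdmitsORR G) ∧
    Nat.card ORR.Group32 = 32 ∧ Nat.card ORR.Group16 = 16 := by
  refine ⟨fun G _ _ hG => ?_, fun G _ hG => hG.not_admitsORR, ORR.card_group32, ORR.card_group16⟩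
  obtain ⟨x, y, z, h⟩ := ORR.exists_isMinTriple hG
  refine ⟨?_, fun hD => ORR.not_admitsORR_of_isGeneralizedDihedral hD h.natCard_ne_two⟩
  by_cases hD : ORR.IsGeneralizedDihedral G
  · exact Or.inl hD
  by_cases hO : ORR.AdmitsORR G
  · exact Or.inr (Or.inl hO)
  exact Or.inr (Or.inr (h.isExceptional hD hO))

theorem theorem3p12 :
    (∀ (G : Type*) [Group G] [Finite G], Group.rank G = 3 →
      (ORR.IsGeneralizedDihedral G ∨ ORR.AdmitsORR G ∨ ORR.IsExceptional G) ∧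
      (ORR.IsGeneralizedDihedral G → ¬ ORR.AdmitsORR G)) ∧
    (∀ (G : Type*) [Group G], ORR.IsExceptional G → ¬ ORR.AdmitsORR G) ∧
    Nat.card ORR.Group32 = 32 ∧ Nat.card ORR.Group16 = 16 :=
  theorem3p12_general.imp_left fun h G _ _ => h G
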